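/- Let $K$ be a field, $n\ge 0$, and let $S=K[X_1,\dots,X_n]$ be $\mathbb{Z}^n$-graded by letting $\deg X_i=\varepsilon_i$ be the $i$-th standard basis vector of $\mathbb{Z}^n$. For $a,b\in\mathbb{Z}^n$ write $|a|=a_1+\dots+a_n$, and write $b\preceq a$ if $b_j\le a_j$ for all $j$. Let $M$ be a $\mathbb{Z}^n$-graded $S$-module that is bounded below, i.e. there is $c\in\mathbb{Z}$ with $M_a=0$ for all $a$ with $|a|\le c$. For $i\in\mathbb{N}$ and $a\in\mathbb{Z}^n$ let $\beta_{i,a}(M)=\dim_K\operatorname{Tor}_i^S(M,K)_a$, where $K=S/(X_1,\dots,X_n)$ is placed in degree $0$, and let $\beta_i(M)=\sum_{a\in\mathbb{Z}^n}\beta_{i,a}(M)$ (these numbers may be infinite cardinals). If $\beta_{p,a}(M)\neq 0$ for some $p\in\mathbb{N}$ and $a\in\mathbb{Z}^n$, then $$\sum_{b\in\mathbb{Z}^n,\ b\preceq a,\ |b|\le |a|-p+i}\beta_{i,b}(M)\ \ge\ \binom{p}{i}\qquad\text{for } i=0,\dots,p.$$ In particular, $\beta_i(M)\ge\binom{p}{i}$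 for $i=0,\dots,p$, and $\sum_{i=0}^{p}\beta_i(M)\ge 2^p$. -/

import Mathlib

noncomputable section

open scoped TensorProduct

namespace MultigradedBetti

universe u v w

/-- The degrees `deg X_i = ε_i` in `ℤ^n` of the variables. -/
def varDegree (n : ℕ) (i : Fin n) : Fin n → ℤ := Pi.single i 1

/-- The natural `ℤ^n`-grading of the polynomial ring `S = K[X_1, …, X_n]`:
`polyGrading K n a` is the `K`-span of the monomials of degree `a`. -/
abbrev polyGrading (K : Type u) [Field K] (n : ℕ) (a : Fin n → ℤ) :
    Submodule K (MvPolynomial (Fin n) K) :=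
  MvPolynomial.weightedHomogeneousSubmodule K (varDegree n) a

/-- `|a| = a_1 + … + a_n`. -/
def totalDegree {n : ℕ} (a : Fin n → ℤ) : ℤ := ∑ i, a i

/-- A family of graded pieces is bounded below if there is `c ∈ ℤ` such that the pieces of degree
`a` with `|a| ≤ c` vanish. -/
def BoundedBelow {K : Type u} [Field K] {n : ℕ} {M : Type v} [AddCommGroup M] [Module K M]
    (𝓜 : (Fin n → ℤ) → Submodule K M) : Prop :=
  ∃ c : ℤ, ∀ a : Fin n → ℤ, totalDegree a ≤ c → 𝓜 a = ⊥

/-- The graded free module `⨁_j S(-deg j)`, with a basis element in degree `deg j` for each `j : ι`,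
is `ι →₀ S` with the following grading: `f` is homogeneous of degree `a` iff each coordinate `f j`
is homogeneous of degree `a - deg j`. -/
def freeGrading (K : Type u) [Field K] {n : ℕ} {ι : Type w} (deg : ι → (Fin n → ℤ))
    (a : Fin n → ℤ) : Submodule K (ι →₀ MvPolynomial (Fin n) K) where
  carrier := {f | ∀ j, f j ∈ polyGrading K n (a - deg j)}
  add_mem' hf hg j := by
    rw [Finsupp.add_apply]; exact Submodule.add_mem _ (hf j) (hg j)
  zero_mem' j := by
    rw [Finsupp.zero_apply]; exact Submodule.zero_mem _
  smul_mem' c f hf j := by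
    rw [Finsupp.smul_apply]; exact Submodule.smul_mem _ c (hf j)

/-- A `ℤ^n`-graded free resolution `⋯ → F_2 → F_1 → F_0 → M → 0` of a `ℤ^n`-graded `S`-module `M`:
an exact sequence with `F_i = ⨁_j S(-deg i j)`, all maps being homogeneous of degree `0`. -/
structure GradedFreeResolution {K : Type u} [Field K] {n : ℕ} {M : Type v} [AddCommGroup M]
    [Module K M] [Module (MvPolynomial (Fin n) K) M] (𝓜 : (Fin n → ℤ) → Submodule K M) where
  /-- The index set of the homogeneous basis of `F_i`. -/
  ι : ℕ → Type (max u v)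
  /-- The degrees of the basis elements of `F_i`. -/
  deg : ∀ i, ι i → (Fin n → ℤ)
  /-- The differential `F_{i+1} → F_i`. -/
  d : ∀ i, (ι (i + 1) →₀ MvPolynomial (Fin n) K) →ₗ[MvPolynomial (Fin n) K]
    (ι i →₀ MvPolynomial (Fin n) K)
  /-- The augmentation `F_0 → M`. -/
  aug : (ι 0 →₀ MvPolynomial (Fin n) K) →ₗ[MvPolynomial (Fin n) K] M
  d_mem : ∀ i a, ∀ f ∈ freeGrading K (deg (i + 1)) a, d i f ∈ freeGrading K (deg i) a
  aug_mem : ∀ a, ∀ f ∈ freeGrading K (deg 0) a, aug f ∈ 𝓜 a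
  aug_surjective : Function.Surjective aug
  exact_aug : Function.Exact (d 0) aug
  exact : ∀ i, Function.Exact (d (i + 1)) (d i)

/-! ### The residue field and graded tensor products -/

/-- The `S`-module `K = S / (X_1, …, X_n)`. -/
abbrev ResidueField (K : Type u) [Field K] (n : ℕ) : Type u :=
  MvPolynomial (Fin n) K ⧸
    Ideal.span (Set.range (MvPolynomial.X : Fin n → MvPolynomial (Fin n) K))

/-- The `S`-module `K` is concentrated in degree `0`. -/
def residueGrading (K : Type u) [Field K] (n : ℕ) (a : Fin n → ℤ) :
    Submodule K (ResidueField K n) :=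
  if a = 0 then ⊤ else ⊥

section TensorProduct

variable (K : Type u) [Field K] (n : ℕ) (F : Type v) [AddCommGroup F] [Module K F]
  [Module (MvPolynomial (Fin n) K) F] [IsScalarTower K (MvPolynomial (Fin n) K) F]
  (N : Type w) [AddCommGroup N] [Module (MvPolynomial (Fin n) K) N]

/-- The tensor product `F ⊗_S N`, with its usual structure of a `K`-vector space. -/
def TensorS : Type (max v w) := F ⊗[MvPolynomial (Fin n) K] N

instance : AddCommGroup (TensorS K n F N) :=
  inferInstanceAs (AddCommGroup (F ⊗[MvPolynomial (Fin n) K] N))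

instance : Module K (TensorS K n F N) :=
  (TensorProduct.leftModule : Module K (F ⊗[MvPolynomial (Fin n) K] N))

variable {F N}

/-- The elementary tensor `f ⊗ y` in `F ⊗_S N`. -/
def TensorS.tmul (f : F) (y : N) : TensorS K n F N := f ⊗ₜ[MvPolynomial (Fin n) K] y

/-- The `K`-linear map `φ ⊗ N : F ⊗_S N → F' ⊗_S N` for an `S`-linear map `φ : F → F'`. -/
def TensorS.map {F' : Type v} [AddCommGroup F'] [Module K F'] [Module (MvPolynomial (Fin n) K) F']
    [IsScalarTower K (MvPolynomial (Fin n) K) F'] (φ : F →ₗ[MvPolynomial (Fin n) K] F') :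
    TensorS K n F N →ₗ[K] TensorS K n F' N :=
  ((φ.rTensor N).restrictScalars K :
    F ⊗[MvPolynomial (Fin n) K] N →ₗ[K] F' ⊗[MvPolynomial (Fin n) K] N)

/-- The grading of `F ⊗_S N` for graded `S`-modules `F` and `N`: the piece of degree `a` is spanned
by the `f ⊗ y` with `f ∈ F_b`, `y ∈ N_c` and `b + c = a`. -/
def tensorGrading [Module K N] (𝓕 : (Fin n → ℤ) → Submodule K F)
    (𝓝 : (Fin n → ℤ) → Submodule K N) (a : Fin n → ℤ) : Submodule K (TensorS K n F N) :=
  Submodule.span K {t | ∃ b c, b + c = a ∧ ∃ f ∈ 𝓕 b, ∃ y ∈ 𝓝 c, t = TensorS.tmul K n f y}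

end TensorProduct

namespace GradedFreeResolution

variable {K : Type u} [Field K] {n : ℕ} {M : Type v} [AddCommGroup M] [Module K M]
  [Module (MvPolynomial (Fin n) K) M] {𝓜 : (Fin n → ℤ) → Submodule K M}

/-- The term `F_i ⊗_S K`. -/
abbrev TensorK (R : GradedFreeResolution 𝓜) (i : ℕ) : Type (max u v) :=
  TensorS K n (R.ι i →₀ MvPolynomial (Fin n) K) (ResidueField K n)

/-- The differential `F_{i+1} ⊗_S K → F_i ⊗_S K`. -/
def tensorD (R : GradedFreeResolution 𝓜) (i : ℕ) : R.TensorK (i + 1) →ₗ[K] R.TensorK i :=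
  TensorS.map K n (R.d i)

/-- The piece `(F_i ⊗_S K)_a`. -/
def chains (R : GradedFreeResolution 𝓜) (i : ℕ) (a : Fin n → ℤ) : Submodule K (R.TensorK i) :=
  tensorGrading K n (freeGrading K (R.deg i)) (residueGrading K n) a

/-- The cycles in `(F_i ⊗_S K)_a`; in homological degree `0` everything is a cycle. -/
def cycles (R : GradedFreeResolution 𝓜) :
    (i : ℕ) → (a : Fin n → ℤ) → Submodule K (R.TensorK i)
  | 0, a => R.chains 0 a
  | i + 1, a => R.chains (i + 1) a ⊓ LinearMap.ker (R.tensorD i)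

/-- The boundaries in `(F_i ⊗_S K)_a`: the image of `(F_{i+1} ⊗_S K)_a`. -/
def boundaries (R : GradedFreeResolution 𝓜) (i : ℕ) (a : Fin n → ℤ) :
    Submodule K (R.TensorK i) :=
  (R.chains (i + 1) a).map (R.tensorD i)

/-- `Tor_i^S(M, K)_a`, the piece of degree `a` of the `i`-th homology of `F ⊗_S K`. -/
abbrev Tor (R : GradedFreeResolution 𝓜) (i : ℕ) (a : Fin n → ℤ) : Type (max u v) :=
  R.cycles i a ⧸ (R.boundaries i a).submoduleOf (R.cycles i a)

end GradedFreeResolution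

/-! ### Existence of graded free resolutions -/

section Existence

variable {K : Type u} [Field K] {n : ℕ}

/-- A finite sum of elements of pairwise different degrees vanishes only if all of them do. -/
def Indep {T : Type w} [AddCommGroup T] [Module K T] (𝓣 : (Fin n → ℤ) → Submodule K T) : Prop :=
  ∀ (s : Finset (Fin n → ℤ)) (t : (Fin n → ℤ) → T), (∀ a, t a ∈ 𝓣 a) →
    ∑ a ∈ s, t a = 0 → ∀ a ∈ s, t a = 0

theorem indep_of_decomposition {T : Type w} [AddCommGroup T] [Module K T]
    (𝓣 : (Fin n → ℤ) → Submodule K T) [DirectSum.Decomposition 𝓣] : Indep 𝓣 := by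
  intro s t ht h a ha
  have h2 := congrArg (fun x => (DirectSum.decompose 𝓣 x a : T)) h
  simp only [DirectSum.decompose_sum, DirectSum.decompose_zero, DirectSum.zero_apply,
    ZeroMemClass.coe_zero] at h2
  rw [DFinsupp.finsetSum_apply, AddSubmonoidClass.coe_finsetSum, Finset.sum_eq_single a] at h2
  · rwa [DirectSum.decompose_of_mem_same 𝓣 (ht a)] at h2
  · intro b _ hb
    exact DirectSum.decompose_of_mem_ne 𝓣 (ht b) hb
  · intro h; exact absurd ha h

theorem indep_freeGrading {ι : Type w} (deg : ι → (Fin n → ℤ)) : Indep (freeGrading K deg) := by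
  intro s t ht h a ha
  let _ := MvPolynomial.weightedDecomposition K (varDegree n)
  ext1 j
  have h1 : ∑ b ∈ s.map (Equiv.subRight (deg j)).toEmbedding, t (b + deg j) j = 0 := by
    rw [Finset.sum_map]
    simpa using congrArg (fun f => f j) h
  have := indep_of_decomposition (polyGrading K n) _ (fun b => t (b + deg j) j)
    (fun b => by simpa using ht (b + deg j) j) h1 (a - deg j)
    (by simpa using ha)
  simpa using this

theorem iSup_freeGrading {ι : Type w} (deg : ι → (Fin n → ℤ)) : ⨆ a, freeGrading K deg a = ⊤ := by
  rw [eq_top_iff]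
  rintro f -
  induction f using Finsupp.induction_linear with
  | zero => exact Submodule.zero_mem _
  | add f g hf hg => exact Submodule.add_mem _ hf hg
  | single j p =>
    induction p using MvPolynomial.induction_on' with
    | monomial m c =>
      refine Submodule.mem_iSup_of_mem (Finsupp.weight (varDegree n) m + deg j) ?_
      intro k
      classical
      rw [Finsupp.single_apply]
      split_ifs with hk
      · subst hk
        rw [add_sub_cancel_right]
        exact MvPolynomial.isWeightedHomogeneous_monomial _ _ _ rfl
      · exact Submodule.zero_mem _
    | add p q hp hq =>
      rw [Finsupp.single_add]; exact Submodule.add_mem _ hp hq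

/-- The submodule `Z` of a graded free module is spanned over `S` by homogeneous elements. -/
def SpannedHomogeneous {ι : Type w} (deg : ι → (Fin n → ℤ))
    (Z : Submodule (MvPolynomial (Fin n) K) (ι →₀ MvPolynomial (Fin n) K)) : Prop :=
  ∀ f ∈ Z, f ∈ Submodule.span (MvPolynomial (Fin n) K) {g | g ∈ Z ∧ ∃ a, g ∈ freeGrading K deg a}

theorem spannedHomogeneous_ker {ι : Type w} (deg : ι → (Fin n → ℤ)) {T : Type v} [AddCommGroup T]
    [Module K T] [Module (MvPolynomial (Fin n) K) T]
    (𝓣 : (Fin n → ℤ) → Submodule K T) (h𝓣 : Indep 𝓣)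
    (φ : (ι →₀ MvPolynomial (Fin n) K) →ₗ[MvPolynomial (Fin n) K] T)
    (hφ : ∀ a, ∀ f ∈ freeGrading K deg a, φ f ∈ 𝓣 a) :
    SpannedHomogeneous deg (LinearMap.ker φ) := by
  intro f hf
  have hmem : f ∈ ⨆ a, freeGrading K deg a := by rw [iSup_freeGrading]; trivial
  obtain ⟨g, hg, rfl⟩ := (Submodule.mem_iSup_iff_exists_finsupp _ _).1 hmem
  have h0 : ∑ a ∈ g.support, φ (g a) = 0 := by
    rw [← map_sum]; exact hf
  have h1 := h𝓣 g.support (fun a => φ (g a)) (fun a => hφ a _ (hg a)) h0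
  exact Submodule.sum_mem _ fun a ha => Submodule.subset_span ⟨h1 a ha, a, hg a⟩

variable {M : Type v} [AddCommGroup M] [Module K M]

theorem linearCombination_mem [Module (MvPolynomial (Fin n) K) M]
    [IsScalarTower K (MvPolynomial (Fin n) K) M]
    (𝓜 : (Fin n → ℤ) → Submodule K M)
    (h𝓜 : ∀ a b, ∀ p ∈ polyGrading K n a, ∀ x ∈ 𝓜 b, p • x ∈ 𝓜 (a + b))
    {ι : Type w} (deg : ι → (Fin n → ℤ)) (x : ι → M) (hx : ∀ j, x j ∈ 𝓜 (deg j))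
    (a : Fin n → ℤ) (f : ι →₀ MvPolynomial (Fin n) K) (hf : f ∈ freeGrading K deg a) :
    Finsupp.linearCombination (MvPolynomial (Fin n) K) x f ∈ 𝓜 a := by
  rw [Finsupp.linearCombination_apply]
  refine Submodule.sum_mem _ fun j _ => ?_
  simpa using h𝓜 _ _ _ (hf j) _ (hx j)

theorem smul_mem_freeGrading {ι : Type w} (deg : ι → (Fin n → ℤ)) (a b : Fin n → ℤ)
    (p : MvPolynomial (Fin n) K) (hp : p ∈ polyGrading K n a)
    (f : ι →₀ MvPolynomial (Fin n) K) (hf : f ∈ freeGrading K deg b) :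
    p • f ∈ freeGrading K deg (a + b) := by
  intro j
  rw [Finsupp.smul_apply, smul_eq_mul, add_sub_assoc]
  exact MvPolynomial.IsWeightedHomogeneous.mul hp (hf j)

variable (K n) in
/-- A graded free module with a graded submodule that is to be resolved. -/
structure Stage where
  ι : Type w
  deg : ι → (Fin n → ℤ)
  Z : Submodule (MvPolynomial (Fin n) K) (ι →₀ MvPolynomial (Fin n) K)
  homog : SpannedHomogeneous deg Z

/-- The homogeneous elements of `Z`. -/
abbrev Stage.Gen (s : Stage.{u, w} K n) : Type (max u w) :=
  Σ a : Fin n → ℤ, {f : s.ι →₀ MvPolynomial (Fin n) K // f ∈ s.Z ∧ f ∈ freeGrading K s.deg a}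

/-- The free module on the homogeneous elements of `Z` maps onto `Z`. -/
def Stage.map (s : Stage.{u, w} K n) :
    (s.Gen →₀ MvPolynomial (Fin n) K) →ₗ[MvPolynomial (Fin n) K]
      (s.ι →₀ MvPolynomial (Fin n) K) :=
  Finsupp.linearCombination (MvPolynomial (Fin n) K) fun g => g.2.1

theorem Stage.map_mem (s : Stage.{u, w} K n) (a : Fin n → ℤ)
    (f : s.Gen →₀ MvPolynomial (Fin n) K)
    (hf : f ∈ freeGrading K (fun g : s.Gen => g.1) a) : s.map f ∈ freeGrading K s.deg a :=
  linearCombination_mem _ (fun a b p hp f hf => smul_mem_freeGrading s.deg a b p hp f hf)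
    (fun g : s.Gen => g.1) _ (fun g => g.2.2.2) a f hf

theorem Stage.range_map (s : Stage.{u, w} K n) : LinearMap.range s.map = s.Z := by
  rw [Stage.map, Finsupp.range_linearCombination]
  apply le_antisymm
  · rw [Submodule.span_le]
    rintro _ ⟨g, rfl⟩
    exact g.2.2.1
  · intro f hf
    refine Submodule.span_mono ?_ (s.homog f hf)
    rintro g ⟨hg, a, ha⟩
    exact ⟨⟨a, g, hg, ha⟩, rfl⟩

theorem Stage.exact_map (s : Stage.{u, w} K n) {T : Type v} [AddCommGroup T]
    [Module (MvPolynomial (Fin n) K) T]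
    (φ : (s.ι →₀ MvPolynomial (Fin n) K) →ₗ[MvPolynomial (Fin n) K] T)
    (hφ : s.Z = LinearMap.ker φ) : Function.Exact s.map φ :=
  LinearMap.exact_iff.2 (by rw [s.range_map, hφ])

/-- The kernel of the map from the free module on the homogeneous elements of `Z`. -/
def Stage.next (s : Stage.{u, max u w} K n) : Stage.{u, max u w} K n where
  ι := s.Gen
  deg g := g.1
  Z := LinearMap.ker s.map
  homog := spannedHomogeneous_ker _ _ (indep_freeGrading s.deg) _ s.map_mem

/-- Every `ℤ^n`-graded `S`-module has a `ℤ^n`-graded free resolution. -/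
theorem nonempty_gradedFreeResolution [Module (MvPolynomial (Fin n) K) M]
    [IsScalarTower K (MvPolynomial (Fin n) K) M]
    (𝓜 : (Fin n → ℤ) → Submodule K M) [DirectSum.Decomposition 𝓜]
    [SetLike.GradedSMul (polyGrading K n) 𝓜] : Nonempty (GradedFreeResolution 𝓜) := by
  let ι₀ : Type (max u v) := ULift.{u} (Σ a : Fin n → ℤ, 𝓜 a)
  let deg₀ : ι₀ → (Fin n → ℤ) := fun g => g.down.1
  let aug : (ι₀ →₀ MvPolynomial (Fin n) K) →ₗ[MvPolynomial (Fin n) K] M :=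
    Finsupp.linearCombination (MvPolynomial (Fin n) K) fun g => (g.down.2 : M)
  have haug : ∀ a, ∀ f ∈ freeGrading K deg₀ a, aug f ∈ 𝓜 a :=
    linearCombination_mem 𝓜 (fun a b p hp x hx => SetLike.GradedSMul.smul_mem hp hx) deg₀ _
      (fun g => g.down.2.2)
  let s₀ : Stage.{u, max u v} K n := ⟨ι₀, deg₀, LinearMap.ker aug,
    spannedHomogeneous_ker _ _ (indep_of_decomposition 𝓜) _ haug⟩
  let s : ℕ → Stage.{u, max u v} K n := fun i => Nat.rec s₀ (fun _ t => Stage.next.{u, v} t) i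
  refine ⟨⟨fun i => (s i).ι, fun i => (s i).deg, fun i => (s i).map, aug, fun i => (s i).map_mem,
    haug, ?_, ?_, ?_⟩⟩
  · intro x
    rw [← LinearMap.mem_range, Finsupp.range_linearCombination]
    classical
    rw [← DirectSum.sum_support_decompose 𝓜 x]
    exact Submodule.sum_mem _ fun a _ =>
      Submodule.subset_span ⟨⟨⟨a, DirectSum.decompose 𝓜 x a⟩⟩, rfl⟩
  · exact s₀.exact_map aug rfl
  · intro i
    exact (Stage.next.{u, v} (s i)).exact_map (s i).map rfl

end Existence

/-! ### Betti numbers -/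

variable {K : Type u} [Field K] {n : ℕ} {M : Type v} [AddCommGroup M] [Module K M]
  [Module (MvPolynomial (Fin n) K) M] [IsScalarTower K (MvPolynomial (Fin n) K) M]

/-- The `ℤ^n`-graded Betti number `β_{i,a}(M) = dim_K Tor_i^S(M, K)_a`, a cardinal, where
`Tor` is computed from a graded free resolution of `M`. -/
def gradedBetti (𝓜 : (Fin n → ℤ) → Submodule K M) [DirectSum.Decomposition 𝓜]
    [SetLike.GradedSMul (polyGrading K n) 𝓜] (i : ℕ) (a : Fin n → ℤ) : Cardinal.{max u v} :=
  Module.rank K ((Classical.choice (nonempty_gradedFreeResolution 𝓜)).Tor i a)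

/-- The total Betti number `β_i(M) = ∑_{a ∈ ℤ^n} β_{i,a}(M)`. -/
def totalBetti (𝓜 : (Fin n → ℤ) → Submodule K M) [DirectSum.Decomposition 𝓜]
    [SetLike.GradedSMul (polyGrading K n) 𝓜] (i : ℕ) : Cardinal.{max u v} :=
  Cardinal.sum fun a : Fin n → ℤ => gradedBetti 𝓜 i a

end MultigradedBetti

end

/-! Betti numbers are computed as Koszul homology, which is built one variable at a time as an
iterated mapping cone. For a module placed in position `0`, `koszulRank` at `(a, i + 1)` is
`β_{i,a}` (`gradedBetti_eq_koszulRank`), and this form permits induction on the number of variables.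

The heart is a stronger bound for torsion-free modules, on which all monomials act injectively:
there `β_{p,a} ≠ 0` forces at least `binom(p+1, i+1)` instead of `binom(p, i)` in the same range of
degrees (`bettiBound_of_torsionFree`). Let `M_c` be the part of degree `c` in the first variable `X`
and `Q_c = M_c / X M_{c-1}`, both modules over the remaining variables. Since `X` is a
nonzerodivisor, `β_{i,(c,b)}(M) = β_{i,b}(Q_c)`. Filtering `M_c` by the images of the `M_e`, `e ≤
c`, bounds `β_{i,b}(M_c)` by the sum of the `β_{i,(e,b)}(M)` with `e ≤ c`.

Let `β_{p,(c,a)}(M) ≠ 0`. If `β_{p,a}(M_c) ≠ 0`, induction applied to `M_c` suffices. Otherwise the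
long exact sequence of `0 → M_{c-1} → M_c → Q_c → 0` gives `β_{p-1,a}(M_{c-1}) ≠ 0`. Then `M_{c-1}`
contributes `binom(p, i+1)` in degrees with first coordinate at most `c - 1`, while `Q_c`, by the
general bound in fewer variables, contributes `binom(p, i)` in degrees with first coordinate `c`.
Pascal's rule adds these to `binom(p+1, i+1)`.

The general bound follows from the torsion-free one applied to the first syzygy module of a minimal
free cover, which shifts `p` and `i` by one (`bettiBound_of_syzygy`). Only `i = 0` needs a separate
argument: a nonzero piece of minimal degree below `a` contains a generator. -/

noncomputable section

namespace MultigradedBetti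

universe u v w w'

/-! ### Ranks of subquotients -/

section Subquotient

variable {K : Type u} [Field K] {W : Type w} [AddCommGroup W] [Module K W]
  {W' : Type w} [AddCommGroup W'] [Module K W']

/-- The dimension of the subquotient `Z / (B ∩ Z)`. -/
def rk (Z B : Submodule K W) : Cardinal.{w} := Module.rank K (Z ⧸ B.submoduleOf Z)

theorem rank_le_of_ker_le {U V T : Type w} [AddCommGroup U] [Module K U] [AddCommGroup V]
    [Module K V] [AddCommGroup T] [Module K T] (f : U →ₗ[K] V) (g : U →ₗ[K] T)
    (hf : Function.Surjective f) (h : ∀ u, g u = 0 → f u = 0) :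
    Module.rank K V ≤ Module.rank K T := by
  have hle : LinearMap.ker g ≤ LinearMap.ker f := fun u hu => h u hu
  have h1 : Module.rank K V ≤ Module.rank K (U ⧸ LinearMap.ker g) :=
    LinearMap.rank_le_of_surjective ((LinearMap.ker g).liftQ f hle) (fun v => by
      obtain ⟨u, rfl⟩ := hf v
      exact ⟨Submodule.Quotient.mk u, rfl⟩)
  refine h1.trans ?_
  rw [(g.quotKerEquivRange).rank_eq]
  exact Submodule.rank_le _

/-- A linear relation between subquotients that is everywhere defined and injective bounds ranks. -/
theorem rk_le_of_relation {Z B : Submodule K W} {Z' B' : Submodule K W'}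
    (Γ : Submodule K (W × W')) (h1 : ∀ z ∈ Z, ∃ w ∈ Z', (z, w) ∈ Γ)
    (h2 : ∀ z ∈ Z, ∀ w ∈ B', (z, w) ∈ Γ → z ∈ B) : rk Z B ≤ rk Z' B' := by
  -- The relation maps onto `Z / B`, and whatever dies in `Z' / B'` already dies in `Z / B`. Working
  -- with relations spares the construction of connecting homomorphisms as maps.
  let U : Submodule K (W × W') := Γ ⊓ Z.prod Z'
  let p : U →ₗ[K] Z := ((LinearMap.fst K W W').comp U.subtype).codRestrict Z fun u => u.2.2.1
  let q : U →ₗ[K] Z' := ((LinearMap.snd K W W').comp U.subtype).codRestrict Z' fun u => u.2.2.2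
  refine rank_le_of_ker_le (((B.submoduleOf Z).mkQ).comp p) (((B'.submoduleOf Z').mkQ).comp q) ?_ ?_
  · refine (Submodule.mkQ_surjective _).comp ?_
    rintro ⟨z, hz⟩
    obtain ⟨w, hw, h⟩ := h1 z hz
    exact ⟨⟨(z, w), h, hz, hw⟩, rfl⟩
  · rintro ⟨⟨z, w⟩, h, hz, hw⟩ hu
    have hu' : w ∈ B' := by
      have := (Submodule.Quotient.mk_eq_zero _).1 hu
      exact this
    exact (Submodule.Quotient.mk_eq_zero _).2 (h2 z hz w hu' h)

theorem mkQ_submoduleOf_eq_zero {Z B : Submodule K W} {z : W} (hz : z ∈ Z) :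
    (B.submoduleOf Z).mkQ ⟨z, hz⟩ = 0 ↔ z ∈ B := Submodule.Quotient.mk_eq_zero _

theorem rk_le_add {Z B Y : Submodule K W} (hBY : B ≤ Y) : rk Z B ≤ rk Z Y + rk (Y ⊓ Z) B := by
  let f : (Z ⧸ B.submoduleOf Z) →ₗ[K] (Z ⧸ Y.submoduleOf Z) :=
    Submodule.factor (Submodule.comap_mono hBY)
  have h := LinearMap.rank_range_add_rank_ker f
  have h0 : Module.rank K (LinearMap.ker f) ≤ rk (Y ⊓ Z) B := by
    let i : (Y ⊓ Z : Submodule K W) →ₗ[K] Z := Submodule.inclusion inf_le_right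
    let g : (Y ⊓ Z : Submodule K W) →ₗ[K] LinearMap.ker f :=
      (((B.submoduleOf Z).mkQ).comp i).codRestrict _ (fun u =>
        (Submodule.Quotient.mk_eq_zero _).2 u.2.1)
    refine rank_le_of_ker_le g ((B.submoduleOf (Y ⊓ Z)).mkQ) ?_ ?_
    · rintro ⟨z, hz⟩
      obtain ⟨⟨z, hz'⟩, rfl⟩ := Submodule.Quotient.mk_surjective _ z
      have : z ∈ Y := (mkQ_submoduleOf_eq_zero hz').1 hz
      exact ⟨⟨z, this, hz'⟩, rfl⟩
    · rintro ⟨z, hz⟩ hu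
      have : z ∈ B := (mkQ_submoduleOf_eq_zero hz).1 hu
      exact Subtype.ext ((Submodule.Quotient.mk_eq_zero _).2 this)
  calc rk Z B = Module.rank K (LinearMap.range f) + Module.rank K (LinearMap.ker f) := h.symm
    _ ≤ _ := add_le_add (Submodule.rank_le _) h0

theorem rk_eq_of_map {Z B : Submodule K W} {Z' B' : Submodule K W'} (φ : W →ₗ[K] W')
    (hZ : ∀ z ∈ Z, φ z ∈ Z') (hB : ∀ z ∈ B, φ z ∈ B')
    (hs : ∀ z' ∈ Z', ∃ z ∈ Z, z' - φ z ∈ B') (hi : ∀ z ∈ Z, φ z ∈ B' → z ∈ B) :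
    rk Z B = rk Z' B' := by
  apply le_antisymm
  · refine rk_le_of_relation
      (LinearMap.eqLocus (φ.comp (LinearMap.fst K W W')) (LinearMap.snd K W W'))
      (fun z hz => ⟨φ z, hZ z hz, rfl⟩) ?_
    rintro z hz w hw (rfl : φ z = w)
    exact hi z hz hw
  · refine rk_le_of_relation
      (B'.comap (LinearMap.fst K W' W - φ.comp (LinearMap.snd K W' W)))
      (fun z hz => hs z hz) ?_
    intro z _ w hw h
    have h' : z - φ w ∈ B' := h
    simpa using B'.add_mem h' (hB w hw)

theorem rk_eq_zero [Subsingleton W] (Z B : Submodule K W) : rk Z B = 0 :=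
  rank_subsingleton' K _

theorem rk_ne_zero {Z B : Submodule K W} (z : W) (hz : z ∈ Z) (hB : z ∉ B) : rk Z B ≠ 0 := by
  rw [rk, Ne, rank_eq_zero_iff]
  intro h
  obtain ⟨r, hr, h0⟩ := h (Submodule.Quotient.mk ⟨z, hz⟩)
  rw [← Submodule.Quotient.mk_smul, Submodule.Quotient.mk_eq_zero] at h0
  have : r • z ∈ B := h0
  exact hB ((Submodule.smul_mem_iff _ hr).1 this)

end Subquotient

/-! ### Complexes of multigraded modules -/

/-- A complex of `ℤ^n`-graded modules over `K[X_1, …, X_n]`, given by its pieces, with the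
multiplication by the monomial of degree `b - a` as a map from degree `a` to degree `b`. -/
structure GradedComplex (K : Type u) [Field K] (n : ℕ) where
  obj : ℤ → (Fin n → ℤ) → Type w
  [addCommGroup : ∀ i a, AddCommGroup (obj i a)]
  [module : ∀ i a, Module K (obj i a)]
  d : ∀ i a, obj i a →ₗ[K] obj (i - 1) a
  x : ∀ i {a b : Fin n → ℤ}, a ≤ b → (obj i a →ₗ[K] obj i b)
  d_d : ∀ i a u, d (i - 1) a (d i a u) = 0
  d_x : ∀ i {a b : Fin n → ℤ} (h : a ≤ b) u, d i b (x i h u) = x (i - 1) h (d i a u)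
  x_refl : ∀ i a u, x i (le_refl a) u = u
  x_x : ∀ i {a b c : Fin n → ℤ} (h : a ≤ b) (h' : b ≤ c) u,
    x i h' (x i h u) = x i (h.trans h') u

attribute [instance] GradedComplex.addCommGroup GradedComplex.module

/-- The degree `(c, a_1, …, a_n)`. -/
abbrev consDeg {n : ℕ} (c : ℤ) (a : Fin n → ℤ) : Fin (n + 1) → ℤ := Fin.cons c a

theorem consDeg_le {n : ℕ} {c d : ℤ} {a b : Fin n → ℤ} (hc : c ≤ d) (h : a ≤ b) :
    consDeg c a ≤ consDeg d b := Fin.cons_le_cons.2 ⟨hc, h⟩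

theorem totalDegree_consDeg {n : ℕ} (c : ℤ) (a : Fin n → ℤ) :
    totalDegree (consDeg c a) = c + totalDegree a := by
  simp [totalDegree, consDeg, Fin.sum_univ_succ]

namespace GradedComplex

variable {K : Type u} [Field K] {n : ℕ}

/-- The part of degree `c` in the first variable. -/
def slice (C : GradedComplex.{u, w} K (n + 1)) (c : ℤ) : GradedComplex.{u, w} K n where
  obj i a := C.obj i (consDeg c a)
  d i _ := C.d i _
  x i _ _ h := C.x i (consDeg_le le_rfl h)
  d_d i _ u := C.d_d i _ u
  d_x i _ _ _ u := C.d_x i _ u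
  x_refl i _ u := C.x_refl i _ u
  x_x i _ _ _ _ _ u := C.x_x i _ _ u

/-- Multiplication with the first variable. -/
def mulX (C : GradedComplex.{u, w} K (n + 1)) (c : ℤ) (i : ℤ) (a : Fin n → ℤ) :
    C.obj i (consDeg (c - 1) a) →ₗ[K] C.obj i (consDeg c a) :=
  C.x i (consDeg_le (by omega) le_rfl)

theorem d_mulX (C : GradedComplex.{u, w} K (n + 1)) (c i a u) :
    C.d i _ (C.mulX c i a u) = C.mulX c (i - 1) a (C.d i _ u) := C.d_x i _ u

theorem x_mulX (C : GradedComplex.{u, w} K (n + 1)) (c i) {a b : Fin n → ℤ} (h : a ≤ b) (u) :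
    C.x i (consDeg_le le_rfl h) (C.mulX c i a u) =
      C.mulX c i b (C.x i (consDeg_le le_rfl h) u) := by
  rw [mulX, mulX, C.x_x, C.x_x]

/-- The mapping cone of multiplication with the first variable. -/
def cone (C : GradedComplex.{u, w} K (n + 1)) (c : ℤ) : GradedComplex.{u, w} K n where
  -- The second factor is the source of multiplication by the first variable, hence the shift by one
  -- both in position and in the first degree.
  obj i a := C.obj i (consDeg c a) × C.obj (i - 1) (consDeg (c - 1) a)
  d i a := LinearMap.prod
    ((C.d i _).comp (LinearMap.fst K _ _) + (C.mulX c (i - 1) a).comp (LinearMap.snd K _ _))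
    (-(C.d (i - 1) _).comp (LinearMap.snd K _ _))
  x i _ _ h := (C.x i (consDeg_le le_rfl h)).prodMap (C.x (i - 1) (consDeg_le le_rfl h))
  d_d i a u := by
    ext
    · simp [C.d_d, C.d_mulX]
    · simp [C.d_d]
  d_x i _ _ h u := by
    ext
    · simpa [C.d_x] using (C.x_mulX c (i - 1) h u.2).symm
    · simp [C.d_x]
  x_refl i a u := by simp [C.x_refl]
  x_x i _ _ _ h h' u := by simp [C.x_x]

theorem cone_d (C : GradedComplex.{u, w} K (n + 1)) (c i a)
    (u : C.obj i (consDeg c a)) (v : C.obj (i - 1) (consDeg (c - 1) a)) :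
    (C.cone c).d i a (u, v) = (C.d i _ u + C.mulX c (i - 1) a v, -C.d (i - 1) _ v) := rfl

theorem cone_x (C : GradedComplex.{u, w} K (n + 1)) (c i) {a b : Fin n → ℤ} (h : a ≤ b)
    (u : C.obj i (consDeg c a)) (v : C.obj (i - 1) (consDeg (c - 1) a)) :
    (C.cone c).x i h (u, v) =
      (C.x i (consDeg_le le_rfl h) u, C.x (i - 1) (consDeg_le le_rfl h) v) := rfl

/-- The part of degree `c` in the first variable of the quotient by the first variable. -/
def quot (C : GradedComplex.{u, w} K (n + 1)) (c : ℤ) : GradedComplex.{u, w} K n where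
  obj i a := C.obj i (consDeg c a) ⧸ LinearMap.range (C.mulX c i a)
  d i a := Submodule.mapQ _ _ (C.d i _) (by
    rintro _ ⟨u, rfl⟩
    exact ⟨C.d i _ u, (C.d_mulX c i a u).symm⟩)
  x i a b h := Submodule.mapQ _ _ (C.x i (consDeg_le le_rfl h)) (by
    rintro _ ⟨u, rfl⟩
    exact ⟨_, (C.x_mulX c i h u).symm⟩)
  d_d i a u := by
    obtain ⟨u, rfl⟩ := Submodule.Quotient.mk_surjective _ u
    exact congrArg Submodule.Quotient.mk (C.d_d i _ u)
  d_x i _ _ h u := by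
    obtain ⟨u, rfl⟩ := Submodule.Quotient.mk_surjective _ u
    exact congrArg Submodule.Quotient.mk (C.d_x i _ u)
  x_refl i a u := by
    obtain ⟨u, rfl⟩ := Submodule.Quotient.mk_surjective _ u
    exact congrArg Submodule.Quotient.mk (C.x_refl i _ u)
  x_x i _ _ _ h h' u := by
    obtain ⟨u, rfl⟩ := Submodule.Quotient.mk_surjective _ u
    exact congrArg Submodule.Quotient.mk (C.x_x i _ _ u)

/-- The quotient map. -/
def toQuot (C : GradedComplex.{u, w} K (n + 1)) (c i : ℤ) (a : Fin n → ℤ) :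
    C.obj i (consDeg c a) →ₗ[K] (C.quot c).obj i a := Submodule.mkQ _

theorem toQuot_surjective (C : GradedComplex.{u, w} K (n + 1)) (c i a) :
    Function.Surjective (C.toQuot c i a) := Submodule.mkQ_surjective _

theorem toQuot_eq_zero (C : GradedComplex.{u, w} K (n + 1)) (c i a u) :
    C.toQuot c i a u = 0 ↔ ∃ v, C.mulX c i a v = u := Submodule.Quotient.mk_eq_zero _

theorem quot_d (C : GradedComplex.{u, w} K (n + 1)) (c i a u) :
    (C.quot c).d i a (C.toQuot c i a u) = C.toQuot c (i - 1) a (C.d i _ u) := rfl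

theorem quot_x (C : GradedComplex.{u, w} K (n + 1)) (c i) {a b : Fin n → ℤ} (h : a ≤ b) (u) :
    (C.quot c).x i h (C.toQuot c i a u) = C.toQuot c i b (C.x i (consDeg_le le_rfl h) u) := rfl

/-- The dimension of the Koszul homology with respect to all variables, in degree `a`, at the
homological position `k - 1`. -/
def koszulRank : {n : ℕ} → GradedComplex.{u, w} K n → (Fin n → ℤ) → ℤ → Cardinal.{w}
  -- At position `k - 1` the kernel and the range lie in literally the same space, so no transport
  -- along `k + 1 - 1 = k` is needed. Hence homology at position `i` is `koszulRank` at `i + 1`.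
  | 0, C, a, k => rk (LinearMap.ker (C.d (k - 1) a)) (LinearMap.range (C.d k a))
  | _ + 1, C, a, k => koszulRank (C.cone (a 0)) (Fin.tail a) k

theorem koszulRank_consDeg (C : GradedComplex.{u, w} K (n + 1)) (c a k) :
    C.koszulRank (consDeg c a) k = (C.cone c).koszulRank a k := rfl

/-- The iterated cone at position `p` is built from the pieces at position `p - |S|` and degree `a -
ε_S`, for sets `S` of variables; all of them satisfy the degree condition of `h`. -/
theorem koszulRank_eq_zero (C : GradedComplex.{u, w} K n) (a : Fin n → ℤ) (p : ℤ)
    (h : ∀ i b, b ≤ a → totalDegree b = totalDegree a - p + i → Subsingleton (C.obj i b)) :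
    C.koszulRank a (p + 1) = 0 := by
  induction n with
  | zero =>
    have : Subsingleton (C.obj (p + 1 - 1) a) := h _ _ le_rfl (by ring)
    exact rk_eq_zero _ _
  | succ n ih =>
    obtain ⟨c, a, rfl⟩ : ∃ c a', a = consDeg c a' := ⟨a 0, Fin.tail a, (Fin.cons_self_tail a).symm⟩
    rw [koszulRank_consDeg]
    refine ih _ _ fun i b hb hd => ?_
    have h1 := h i (consDeg c b) (consDeg_le le_rfl hb)
      (by rw [totalDegree_consDeg, totalDegree_consDeg, hd]; ring)
    have h2 := h (i - 1) (consDeg (c - 1) b) (consDeg_le (by omega) hb)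
      (by rw [totalDegree_consDeg, totalDegree_consDeg, hd]; ring)
    exact inferInstanceAs (Subsingleton (C.obj i (consDeg c b) × C.obj (i - 1) (consDeg (c - 1) b)))

/-- In the lowest position everything is a cycle, and the only possible sources of boundaries,
position `k` in degree `a` and position `k - 1` in smaller degrees, vanish. All hypotheses pass to
the cone. -/
theorem koszulRank_ne_zero (C : GradedComplex.{u, w} K n) (a : Fin n → ℤ) (k : ℤ)
    (h0 : ∀ i < k - 1, ∀ b, Subsingleton (C.obj i b)) (h1 : Nontrivial (C.obj (k - 1) a))
    (h2 : Subsingleton (C.obj k a))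
    (h3 : ∀ b ≤ a, b ≠ a → Subsingleton (C.obj (k - 1) b)) :
    C.koszulRank a k ≠ 0 := by
  induction n with
  | zero =>
    obtain ⟨z, hz⟩ := exists_ne (0 : C.obj (k - 1) a)
    have := h0 (k - 1 - 1) (by omega) a
    refine rk_ne_zero z (Subsingleton.elim _ _) ?_
    rintro ⟨y, rfl⟩
    rw [Subsingleton.elim y 0, map_zero] at hz
    exact hz rfl
  | succ n ih =>
    obtain ⟨c, a, rfl⟩ : ∃ c a', a = consDeg c a' := ⟨a 0, Fin.tail a, (Fin.cons_self_tail a).symm⟩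
    rw [koszulRank_consDeg]
    refine ih _ _ (fun i hi b => ?_) ?_ ?_ (fun b hb hne => ?_)
    · have := h0 i hi (consDeg c b)
      have := h0 (i - 1) (by omega) (consDeg (c - 1) b)
      exact inferInstanceAs
        (Subsingleton (C.obj i (consDeg c b) × C.obj (i - 1) (consDeg (c - 1) b)))
    · exact inferInstanceAs
        (Nontrivial (C.obj (k - 1) (consDeg c a) × C.obj (k - 1 - 1) (consDeg (c - 1) a)))
    · have := h3 (consDeg (c - 1) a) (consDeg_le (by omega) le_rfl) (fun h => by
        have := congrFun h 0
        simp at this)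
      exact inferInstanceAs
        (Subsingleton (C.obj k (consDeg c a) × C.obj (k - 1) (consDeg (c - 1) a)))
    · have := h3 (consDeg c b) (consDeg_le le_rfl hb) (fun h => hne (by simpa using congrArg Fin.tail h))
      have := h0 (k - 1 - 1) (by omega) (consDeg (c - 1) b)
      exact inferInstanceAs
        (Subsingleton (C.obj (k - 1) (consDeg c b) × C.obj (k - 1 - 1) (consDeg (c - 1) b)))

end GradedComplex

/-! ### Short exact sequences and the inequalities of the long exact sequence -/

namespace GradedComplex

variable {K : Type u} [Field K] {n : ℕ}

/-- A short exact sequence `0 → A → B → C → 0` of complexes. -/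
structure ShortExactSeq (A B C : GradedComplex.{u, w} K n) where
  f : ∀ i a, A.obj i a →ₗ[K] B.obj i a
  g : ∀ i a, B.obj i a →ₗ[K] C.obj i a
  f_d : ∀ i a u, f (i - 1) a (A.d i a u) = B.d i a (f i a u)
  g_d : ∀ i a u, g (i - 1) a (B.d i a u) = C.d i a (g i a u)
  f_x : ∀ i {a b : Fin n → ℤ} (h : a ≤ b) u, f i b (A.x i h u) = B.x i h (f i a u)
  g_x : ∀ i {a b : Fin n → ℤ} (h : a ≤ b) u, g i b (B.x i h u) = C.x i h (g i a u)
  f_injective : ∀ i a, Function.Injective (f i a)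
  g_surjective : ∀ i a, Function.Surjective (g i a)
  g_f : ∀ i a u, g i a (f i a u) = 0
  exact : ∀ i a v, g i a v = 0 → ∃ u, f i a u = v

namespace ShortExactSeq

/-- The short exact sequence of mapping cones. -/
def cone {A B C : GradedComplex.{u, w} K (n + 1)} (s : ShortExactSeq A B C) (c : ℤ) :
    ShortExactSeq (A.cone c) (B.cone c) (C.cone c) where
  f i a := (s.f i _).prodMap (s.f (i - 1) _)
  g i a := (s.g i _).prodMap (s.g (i - 1) _)
  f_d i a u := by
    obtain ⟨u, v⟩ := u
    refine Prod.ext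
      (?_ : s.f (i - 1) _ (A.d i _ u + A.mulX c (i - 1) a v) =
        B.d i _ (s.f i _ u) + B.mulX c (i - 1) a (s.f (i - 1) _ v))
      (?_ : s.f (i - 1 - 1) _ (-A.d (i - 1) _ v) = -B.d (i - 1) _ (s.f (i - 1) _ v))
    · rw [map_add, s.f_d, mulX, mulX, s.f_x]
    · rw [map_neg, s.f_d]
  g_d i a u := by
    obtain ⟨u, v⟩ := u
    refine Prod.ext
      (?_ : s.g (i - 1) _ (B.d i _ u + B.mulX c (i - 1) a v) =
        C.d i _ (s.g i _ u) + C.mulX c (i - 1) a (s.g (i - 1) _ v))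
      (?_ : s.g (i - 1 - 1) _ (-B.d (i - 1) _ v) = -C.d (i - 1) _ (s.g (i - 1) _ v))
    · rw [map_add, s.g_d, mulX, mulX, s.g_x]
    · rw [map_neg, s.g_d]
  f_x i _ _ h u := Prod.ext (s.f_x i _ u.1) (s.f_x (i - 1) _ u.2)
  g_x i _ _ h u := Prod.ext (s.g_x i _ u.1) (s.g_x (i - 1) _ u.2)
  f_injective i a := (s.f_injective i _).prodMap (s.f_injective (i - 1) _)
  g_surjective i a := (s.g_surjective i _).prodMap (s.g_surjective (i - 1) _)
  g_f i a u := Prod.ext (s.g_f i _ u.1) (s.g_f (i - 1) _ u.2)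
  exact i a v h := by
    obtain ⟨u1, h1⟩ := s.exact i _ v.1 (congrArg Prod.fst h)
    obtain ⟨u2, h2⟩ := s.exact (i - 1) _ v.2 (congrArg Prod.snd h)
    exact ⟨(u1, u2), Prod.ext h1 h2⟩

variable {A B C : GradedComplex.{u, w} K n}

/-- The relation behind the connecting homomorphism. -/
def connecting (s : ShortExactSeq A B C) (i : ℤ) (a : Fin n → ℤ) :
    Submodule K (C.obj i a × A.obj (i - 1) a) :=
  (LinearMap.eqLocus ((B.d i a).comp (LinearMap.fst K (B.obj i a) (A.obj (i - 1) a)))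
    ((s.f (i - 1) a).comp (LinearMap.snd K (B.obj i a) (A.obj (i - 1) a)))).map
    ((s.g i a).prodMap LinearMap.id)

theorem mem_connecting (s : ShortExactSeq A B C) (i a u v) :
    (u, v) ∈ s.connecting i a ↔ ∃ b, s.g i a b = u ∧ B.d i a b = s.f (i - 1) a v := by
  constructor
  · rintro ⟨⟨b, v'⟩, h, h'⟩
    obtain ⟨rfl, rfl⟩ := Prod.ext_iff.1 h'
    exact ⟨b, rfl, h⟩
  · rintro ⟨b, rfl, h⟩
    exact ⟨(b, v), h, rfl⟩

/-- The relation behind the connecting homomorphism, from `A` to `C`. -/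
def connectingSymm (s : ShortExactSeq A B C) (i : ℤ) (a : Fin n → ℤ) :
    Submodule K (A.obj (i - 1) a × C.obj i a) :=
  (s.connecting i a).comap ((LinearMap.snd K (A.obj (i - 1) a) (C.obj i a)).prod
    (LinearMap.fst K (A.obj (i - 1) a) (C.obj i a)))

theorem mem_connectingSymm (s : ShortExactSeq A B C) (i a u v) :
    (v, u) ∈ s.connectingSymm i a ↔ ∃ b, s.g i a b = u ∧ B.d i a b = s.f (i - 1) a v :=
  s.mem_connecting i a u v

/-- Cones preserve short exact sequences, so this and the next inequalities reduce to ordinary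
homology of complexes of vector spaces. -/
theorem koszulRank_middle_le (s : ShortExactSeq A B C) (a k) :
    B.koszulRank a k ≤ A.koszulRank a k + C.koszulRank a k := by
  induction n with
  | succ n ih => exact ih (s.cone _) _
  | zero =>
    -- `Y` collects the elements whose image in `C` is a boundary; its cycles come from cycles of
    -- `A` up to boundaries.
    let Y : Submodule K (B.obj (k - 1) a) :=
      (LinearMap.range (C.d k a)).comap (s.g (k - 1) a)
    rw [add_comm]
    refine (rk_le_add (Y := Y) ?_).trans (add_le_add ?_ ?_)
    · rintro _ ⟨v, rfl⟩
      exact ⟨s.g k a v, (s.g_d k a v).symm⟩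
    · refine rk_le_of_relation (LinearMap.eqLocus
        ((s.g (k - 1) a).comp (LinearMap.fst K _ _)) (LinearMap.snd K _ _)) ?_ ?_
      · intro z hz
        refine ⟨s.g (k - 1) a z, ?_, rfl⟩
        rw [LinearMap.mem_ker] at hz ⊢
        rw [← s.g_d, hz, map_zero]
      · rintro z - w hw (rfl : s.g (k - 1) a z = w)
        exact hw
    · refine rk_le_of_relation ((LinearMap.range (B.d k a)).comap
        (LinearMap.fst K _ _ - (s.f (k - 1) a).comp (LinearMap.snd K _ _))) ?_ ?_
      · rintro z ⟨⟨c, hc⟩, hz⟩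
        obtain ⟨b, rfl⟩ := s.g_surjective k a c
        obtain ⟨u, hu⟩ := s.exact (k - 1) a (z - B.d k a b) (by rw [map_sub, s.g_d, hc, sub_self])
        refine ⟨u, ?_, ⟨b, ?_⟩⟩
        · apply s.f_injective
          rw [s.f_d, hu, map_zero, map_sub, B.d_d, sub_zero]
          exact hz
        · change _ = z - s.f (k - 1) a u
          rw [hu]; abel
      · rintro z - _ ⟨u, rfl⟩ ⟨b, hb⟩
        refine ⟨b + s.f k a u, ?_⟩
        rw [map_add, hb, ← s.f_d]
        change z - s.f (k - 1) a (A.d k a u) + _ = z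
        abel

theorem koszulRank_right_le (s : ShortExactSeq A B C) (a k) :
    C.koszulRank a k ≤ B.koszulRank a k + A.koszulRank a (k - 1) := by
  induction n with
  | succ n ih => exact ih (s.cone _) _
  | zero =>
    -- `Y` is the image of the cycles of `B`; modulo `Y` the connecting relation is injective.
    let Y : Submodule K (C.obj (k - 1) a) :=
      (LinearMap.ker (B.d (k - 1) a)).map (s.g (k - 1) a)
    rw [add_comm]
    refine (rk_le_add (Y := Y) ?_).trans (add_le_add ?_ ?_)
    · rintro _ ⟨v, rfl⟩
      obtain ⟨b, rfl⟩ := s.g_surjective k a v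
      exact ⟨B.d k a b, B.d_d k a b, s.g_d k a b⟩
    · refine rk_le_of_relation (s.connecting (k - 1) a) ?_ ?_
      · intro z hz
        obtain ⟨b, rfl⟩ := s.g_surjective _ a z
        obtain ⟨u, hu⟩ := s.exact _ a (B.d (k - 1) a b) (by rw [s.g_d]; exact hz)
        refine ⟨u, ?_, (s.mem_connecting _ _ _ _).2 ⟨b, rfl, hu.symm⟩⟩
        apply s.f_injective
        rw [s.f_d, hu, map_zero, B.d_d]
      · rintro z - _ ⟨u, rfl⟩ h
        obtain ⟨b, rfl, hb⟩ := (s.mem_connecting _ _ _ _).1 h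
        refine ⟨b - s.f _ a u, ?_, ?_⟩
        · change B.d (k - 1) a (b - s.f _ a u) = 0
          rw [map_sub, hb, s.f_d, sub_self]
        · rw [map_sub, s.g_f, sub_zero]
    · refine rk_le_of_relation ((LinearMap.range (C.d k a)).comap
        (LinearMap.fst K _ _ - (s.g (k - 1) a).comp (LinearMap.snd K _ _))) ?_ ?_
      · rintro z ⟨⟨b, hb, rfl⟩, -⟩
        exact ⟨b, hb, ⟨0, by simp⟩⟩
      · rintro z - _ ⟨b, rfl⟩ ⟨c, hc⟩
        refine ⟨c + s.g k a b, ?_⟩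
        rw [map_add, hc, ← s.g_d]
        change z - s.g (k - 1) a (B.d k a b) + _ = z
        abel

/-- Classes of `A` that become boundaries in `B` come from `C` under the connecting homomorphism. -/
theorem rk_connectingSymm_le {A B C : GradedComplex.{u, w} K n} (s : ShortExactSeq A B C) (a k)
    (Z : Submodule K (A.obj (k - 1 - 1) a))
    (hZ : ∀ z ∈ Z, s.f (k - 1 - 1) a z ∈ LinearMap.range (B.d (k - 1) a)) :
    rk Z (LinearMap.range (A.d (k - 1) a)) ≤
      rk (LinearMap.ker (C.d (k - 1) a)) (LinearMap.range (C.d k a)) := by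
  refine rk_le_of_relation (s.connectingSymm (k - 1) a) ?_ ?_
  · intro z hz
    obtain ⟨b, hb⟩ := hZ z hz
    refine ⟨s.g _ a b, ?_, (s.mem_connectingSymm _ _ _ _).2 ⟨b, rfl, hb⟩⟩
    change C.d (k - 1) a (s.g _ a b) = 0
    rw [← s.g_d, hb, s.g_f]
  · rintro z - _ ⟨c, rfl⟩ h
    obtain ⟨b, hb, hb'⟩ := (s.mem_connectingSymm _ _ _ _).1 h
    obtain ⟨b₁, rfl⟩ := s.g_surjective k a c
    obtain ⟨u, hu⟩ := s.exact _ a (b - B.d k a b₁) (by rw [map_sub, hb, s.g_d, sub_self])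
    refine ⟨u, s.f_injective _ a ?_⟩
    rw [s.f_d, hu, map_sub, B.d_d, hb', sub_zero]

theorem koszulRank_left_le (s : ShortExactSeq A B C) (a k) :
    A.koszulRank a (k - 1) ≤ C.koszulRank a k + B.koszulRank a (k - 1) := by
  induction n with
  | succ n ih => exact ih (s.cone _) _
  | zero =>
    let Y : Submodule K (A.obj (k - 1 - 1) a) :=
      (LinearMap.range (B.d (k - 1) a)).comap (s.f (k - 1 - 1) a)
    rw [add_comm]
    refine (rk_le_add (Y := Y) ?_).trans (add_le_add ?_ ?_)
    · rintro _ ⟨v, rfl⟩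
      exact ⟨s.f _ a v, (s.f_d _ a v).symm⟩
    · refine rk_le_of_relation (LinearMap.eqLocus
        ((s.f (k - 1 - 1) a).comp (LinearMap.fst K _ _)) (LinearMap.snd K _ _)) ?_ ?_
      · intro z hz
        refine ⟨s.f _ a z, ?_, rfl⟩
        rw [LinearMap.mem_ker] at hz ⊢
        rw [← s.f_d, hz, map_zero]
      · rintro z - w hw (rfl : s.f (k - 1 - 1) a z = w)
        exact hw
    · exact s.rk_connectingSymm_le a k _ fun z hz => hz.1

end ShortExactSeq

/-! ### Monomial ideals acting on a complex -/

/-- The part of degree `a` of `(X_j : j < k) C_i`. -/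
def varSubmodule (C : GradedComplex.{u, w} K n) (i : ℤ) (a : Fin n → ℤ) (k : ℕ) :
    Submodule K (C.obj i a) :=
  ⨆ b : Fin n → ℤ, ⨆ h : b ≤ a, ⨆ _ : ∃ j : Fin n, j.val < k ∧ b j < a j, LinearMap.range (C.x i h)

theorem x_mem_varSubmodule (C : GradedComplex.{u, w} K n) (i) {a b : Fin n → ℤ} {k : ℕ} (h : b ≤ a)
    (hj : ∃ j : Fin n, j.val < k ∧ b j < a j) (u) : C.x i h u ∈ C.varSubmodule i a k :=
  Submodule.mem_iSup_of_mem b (Submodule.mem_iSup_of_mem h (Submodule.mem_iSup_of_mem hj ⟨u, rfl⟩))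

theorem varSubmodule_le {C : GradedComplex.{u, w} K n} {i a k} {N : Submodule K (C.obj i a)}
    (h : ∀ (b : Fin n → ℤ) (h : b ≤ a), (∃ j : Fin n, j.val < k ∧ b j < a j) →
      ∀ u, C.x i h u ∈ N) : C.varSubmodule i a k ≤ N := by
  refine iSup_le fun b => iSup_le fun hb => iSup_le fun hj => ?_
  rintro _ ⟨u, rfl⟩
  exact h b hb hj u

theorem varSubmodule_zero (C : GradedComplex.{u, w} K n) (i a) : C.varSubmodule i a 0 = ⊥ :=
  le_bot_iff.1 (varSubmodule_le (by simp))

/-- A monomial divisible by one of the first `k + 1` variables is divisible by the first variable,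
or does not involve it and is divisible by one of the next `k`. -/
theorem x_consDeg_cases (C : GradedComplex.{u, w} K (n + 1)) (i : ℤ) {c : ℤ} {a : Fin n → ℤ}
    {k : ℕ} {b : Fin (n + 1) → ℤ} (h : b ≤ consDeg c a)
    (hj : ∃ j : Fin (n + 1), j.val < k + 1 ∧ b j < consDeg c a j) (u : C.obj i b) :
    (∃ v, C.x i h u = C.mulX c i a v) ∨
    ∃ (b' : Fin n → ℤ) (h' : b' ≤ a) (_ : ∃ j : Fin n, j.val < k ∧ b' j < a j) (v : _),
      C.x i h u = C.x i (consDeg_le (le_refl c) h') v := by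
  obtain ⟨e, b, rfl⟩ : ∃ e b', b = consDeg e b' := ⟨b 0, Fin.tail b, (Fin.cons_self_tail b).symm⟩
  obtain ⟨he, hb⟩ := Fin.cons_le_cons.1 h
  rcases he.lt_or_eq with he | rfl
  · left
    exact ⟨C.x i (consDeg_le (by omega) hb) u, by rw [mulX, C.x_x]⟩
  · right
    obtain ⟨j, hjk, hj⟩ := hj
    refine ⟨b, hb, ?_, u, rfl⟩
    refine Fin.cases ?_ (fun j hjk hj => ?_) j hjk hj
    · intro _ hj
      simp at hj
    · exact ⟨j, by simpa using hjk, by simpa using hj⟩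

/-- In the lowest position the hypothesis says that `A → B` vanishes on homology modulo the
variables, so the term for `B` in `koszulRank_left_le` disappears. -/
theorem ShortExactSeq.koszulRank_left_le_of_minimal {A B C : GradedComplex.{u, w} K n}
    (s : ShortExactSeq A B C) (a k)
    (hA : ∀ i < k - 1 - 1, ∀ b, Subsingleton (A.obj i b))
    (hB : ∀ i < k - 1 - 1, ∀ b, Subsingleton (B.obj i b))
    (h : ∀ b u, s.f (k - 1 - 1) b u ∈
      LinearMap.range (B.d (k - 1) b) ⊔ B.varSubmodule (k - 1 - 1) b n) :
    A.koszulRank a (k - 1) ≤ C.koszulRank a k := by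
  induction n with
  | zero =>
    refine s.rk_connectingSymm_le a k _ fun z _ => ?_
    simpa [varSubmodule_zero] using h a z
  | succ n ih =>
    obtain ⟨c, a, rfl⟩ : ∃ c a', a = consDeg c a' := ⟨a 0, Fin.tail a, (Fin.cons_self_tail a).symm⟩
    rw [koszulRank_consDeg, koszulRank_consDeg]
    refine ih (s.cone c) _ (fun i hi b => ?_) (fun i hi b => ?_) fun b u => ?_
    · have := hA i hi (consDeg c b)
      have := hA (i - 1) (by omega) (consDeg (c - 1) b)
      exact inferInstanceAs
        (Subsingleton (A.obj i (consDeg c b) × A.obj (i - 1) (consDeg (c - 1) b)))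
    · have := hB i hi (consDeg c b)
      have := hB (i - 1) (by omega) (consDeg (c - 1) b)
      exact inferInstanceAs
        (Subsingleton (B.obj i (consDeg c b) × B.obj (i - 1) (consDeg (c - 1) b)))
    · obtain ⟨u, v⟩ := u
      -- In the lowest position the cone has no second component.
      have := hB (k - 1 - 1 - 1) (by omega) (consDeg (c - 1) b)
      let ι : B.obj (k - 1 - 1) (consDeg c b) →ₗ[K] (B.cone c).obj (k - 1 - 1) b :=
        LinearMap.inl K (B.obj (k - 1 - 1) (consDeg c b))
          (B.obj (k - 1 - 1 - 1) (consDeg (c - 1) b))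
      have hι : (s.cone c).f (k - 1 - 1) b (u, v) = ι (s.f (k - 1 - 1) _ u) :=
        Prod.ext rfl (Subsingleton.elim _ _)
      rw [hι, ← Submodule.mem_comap]
      refine SetLike.le_def.1 (sup_le ?_ ?_) (h (consDeg c b) u)
      · rintro _ ⟨y, rfl⟩
        refine Submodule.mem_sup_left ⟨(y, 0), ?_⟩
        rw [cone_d]
        exact Prod.ext (by rw [map_zero, add_zero]; rfl) (Subsingleton.elim _ _)
      · refine varSubmodule_le fun b' hb' hj y => ?_
        -- Multiples of the first variable become boundaries in the cone; the others remain
        -- multiples of the remaining variables.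
        rcases B.x_consDeg_cases _ hb' hj y with ⟨v, hv⟩ | ⟨b'', h', hj', v, hv⟩
        · refine Submodule.mem_sup_left ⟨(0, v), ?_⟩
          rw [cone_d, hv]
          exact Prod.ext (by rw [map_zero, zero_add]; rfl) (Subsingleton.elim _ _)
        · refine Submodule.mem_sup_right ?_
          rw [hv]
          convert (B.cone c).x_mem_varSubmodule (k - 1 - 1) h' hj' (v, 0)
          rw [cone_x, map_zero]
          rfl

/-! ### Surjective quasi-isomorphisms -/

/-- Surjective maps of complexes with an acyclic kernel. -/
structure SurjQuasiIso (B C : GradedComplex.{u, w} K n) where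
  g : ∀ i a, B.obj i a →ₗ[K] C.obj i a
  g_d : ∀ i a u, g (i - 1) a (B.d i a u) = C.d i a (g i a u)
  g_x : ∀ i {a b : Fin n → ℤ} (h : a ≤ b) u, g i b (B.x i h u) = C.x i h (g i a u)
  g_surjective : ∀ i a, Function.Surjective (g i a)
  acyclic : ∀ i a u, g (i - 1) a u = 0 → B.d (i - 1) a u = 0 →
    ∃ v, g i a v = 0 ∧ B.d i a v = u

namespace SurjQuasiIso

/-- The induced map of mapping cones. -/
def cone {B C : GradedComplex.{u, w} K (n + 1)} (s : SurjQuasiIso B C) (c : ℤ) :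
    SurjQuasiIso (B.cone c) (C.cone c) where
  g i a := (s.g i _).prodMap (s.g (i - 1) _)
  g_d i a u := by
    obtain ⟨u, v⟩ := u
    refine Prod.ext
      (?_ : s.g (i - 1) _ (B.d i _ u + B.mulX c (i - 1) a v) =
        C.d i _ (s.g i _ u) + C.mulX c (i - 1) a (s.g (i - 1) _ v))
      (?_ : s.g (i - 1 - 1) _ (-B.d (i - 1) _ v) = -C.d (i - 1) _ (s.g (i - 1) _ v))
    · rw [map_add, s.g_d, mulX, mulX, s.g_x]
    · rw [map_neg, s.g_d]
  g_x i _ _ h u := Prod.ext (s.g_x i _ u.1) (s.g_x (i - 1) _ u.2)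
  g_surjective i a := (s.g_surjective i _).prodMap (s.g_surjective (i - 1) _)
  acyclic i a u h1 h2 := by
    obtain ⟨u, v⟩ := u
    rw [cone_d] at h2
    obtain ⟨h3, h4⟩ := Prod.ext_iff.1 h2
    obtain ⟨h5, h6⟩ := Prod.ext_iff.1 h1
    obtain ⟨v', hv', hv⟩ := s.acyclic (i - 1) (consDeg (c - 1) a) v h6 (neg_eq_zero.1 h4)
    obtain ⟨u', hu', hu⟩ := s.acyclic i (consDeg c a) (u + B.mulX c (i - 1) a v')
      (by
        rw [map_add, mulX, s.g_x, hv', map_zero, add_zero]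
        exact h5)
      (by
        rw [map_add, d_mulX, hv]
        exact h3)
    refine ⟨(u', -v'), Prod.ext hu' ?_, ?_⟩
    · exact (map_neg _ _).trans (neg_eq_zero.2 hv')
    · rw [cone_d, hu, map_neg, map_neg, hv]
      exact Prod.ext (by simp) (by simp)

theorem koszulRank_eq {B C : GradedComplex.{u, w} K n} (s : SurjQuasiIso B C) (a k) :
    B.koszulRank a k = C.koszulRank a k := by
  induction n with
  | succ n ih => exact ih (s.cone _) _
  | zero =>
    refine rk_eq_of_map (s.g (k - 1) a) ?_ ?_ ?_ ?_
    · intro z hz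
      change C.d (k - 1) a _ = 0
      rw [← s.g_d, LinearMap.mem_ker.1 hz, map_zero]
    · rintro _ ⟨z, rfl⟩
      exact ⟨s.g k a z, (s.g_d k a z).symm⟩
    · intro z hz
      obtain ⟨b, rfl⟩ := s.g_surjective _ a z
      obtain ⟨v, hv, hv'⟩ := s.acyclic (k - 1) a (B.d (k - 1) a b) (by rw [s.g_d]; exact hz)
        (B.d_d _ a b)
      refine ⟨b - v, ?_, 0, ?_⟩
      · change B.d (k - 1) a (b - v) = 0
        rw [map_sub, hv', sub_self]
      · rw [map_sub, hv]; simp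
    · rintro z hz ⟨c, hc⟩
      obtain ⟨b, rfl⟩ := s.g_surjective _ a c
      obtain ⟨v, hv, hv'⟩ := s.acyclic k a (z - B.d k a b) (by rw [map_sub, s.g_d, hc, sub_self])
        (by rw [map_sub, B.d_d, sub_zero]; exact hz)
      exact ⟨v + b, by rw [map_add, hv']; abel⟩

end SurjQuasiIso

/-- If the first variable is a nonzerodivisor, then the mapping cone is quasi-isomorphic to the
quotient. -/
def coneToQuot (C : GradedComplex.{u, w} K (n + 1)) (c : ℤ)
    (h : ∀ i a, Function.Injective (C.mulX c i a)) : SurjQuasiIso (C.cone c) (C.quot c) where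
  g i a := (C.toQuot c i a).comp (LinearMap.fst K _ _)
  g_d i a u := by
    obtain ⟨u, v⟩ := u
    rw [cone_d]
    change C.toQuot c (i - 1) a (C.d i _ u + C.mulX c (i - 1) a v) = C.toQuot c (i - 1) a (C.d i _ u)
    rw [map_add, (C.toQuot_eq_zero c _ _ _).2 ⟨v, rfl⟩, add_zero]
  g_x i _ _ h u := rfl
  g_surjective i a := (C.toQuot_surjective c i a).comp Prod.fst_surjective
  acyclic i a u h1 h2 := by
    obtain ⟨u, v⟩ := u
    obtain ⟨w, rfl⟩ := (C.toQuot_eq_zero c _ _ _).1 h1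
    rw [cone_d, d_mulX, ← map_add] at h2
    -- A cycle `(X w, v)` satisfies `X (d w + v) = 0`. Cancelling `X` gives `v = -d w`, so it is the
    -- boundary of `(0, w)`.
    have h3 := h _ _ ((congrArg Prod.fst h2).trans (map_zero (C.mulX c (i - 1 - 1) a)).symm)
    refine ⟨(0, w), map_zero (C.toQuot c i a), ?_⟩
    rw [cone_d, map_zero, zero_add, ← eq_neg_of_add_eq_zero_right h3]

theorem koszulRank_consDeg_of_injective (C : GradedComplex.{u, w} K (n + 1)) (c a k)
    (h : ∀ i a, Function.Injective (C.mulX c i a)) :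
    C.koszulRank (consDeg c a) k = (C.quot c).koszulRank a k :=
  (C.coneToQuot c h).koszulRank_eq a k

/-- The short exact sequence of the multiplication with the first variable. -/
def sliceSeq (C : GradedComplex.{u, w} K (n + 1)) (c : ℤ)
    (h : ∀ i a, Function.Injective (C.mulX c i a)) :
    ShortExactSeq (C.slice (c - 1)) (C.slice c) (C.quot c) where
  f i a := C.mulX c i a
  g i a := C.toQuot c i a
  f_d i a u := (C.d_mulX c i a u).symm
  g_d _ _ _ := rfl
  f_x i _ _ h u := (C.x_mulX c i h u).symm
  g_x _ _ _ _ _ := rfl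
  f_injective i a := h i a
  g_surjective i a := C.toQuot_surjective c i a
  g_f i a u := (C.toQuot_eq_zero c i a _).2 ⟨u, rfl⟩
  exact i a v h := (C.toQuot_eq_zero c i a v).1 h

/-! ### Complexes on which the variables form a regular sequence -/

/-- Levelwise, the variables form a regular sequence. -/
def Regular (C : GradedComplex.{u, w} K n) : Prop :=
  -- The monomial of degree `a - b` does not involve the first `k` variables, so it must act
  -- injectively modulo these.
  ∀ (i : ℤ) (k : ℕ) (a b : Fin n → ℤ) (h : b ≤ a), (∀ j : Fin n, j.val < k → b j = a j) →
    ∀ u, C.x i h u ∈ C.varSubmodule i a k → u ∈ C.varSubmodule i b k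

theorem Regular.x_injective {C : GradedComplex.{u, w} K n} (hC : C.Regular) (i)
    {a b : Fin n → ℤ} (h : a ≤ b) : Function.Injective (C.x i h) := by
  rw [injective_iff_map_eq_zero]
  intro u hu
  simpa [varSubmodule_zero] using hC i 0 b a h (by simp) u (by simp [varSubmodule_zero, hu])

theorem toQuot_mem_varSubmodule (C : GradedComplex.{u, w} K (n + 1)) (c i a k u) :
    C.toQuot c i a u ∈ (C.quot c).varSubmodule i a k ↔
      u ∈ C.varSubmodule i (consDeg c a) (k + 1) := by
  constructor
  · intro h
    have h1 : (C.quot c).varSubmodule i a k ≤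
        (C.varSubmodule i (consDeg c a) (k + 1)).map (C.toQuot c i a) := by
      refine varSubmodule_le fun b hb hj v => ?_
      obtain ⟨v, rfl⟩ := C.toQuot_surjective c i b v
      obtain ⟨j, hj, hj'⟩ := hj
      exact ⟨_, C.x_mem_varSubmodule i (consDeg_le le_rfl hb)
        ⟨j.succ, by simpa using hj, by simpa using hj'⟩ v, rfl⟩
    obtain ⟨v, hv, hv'⟩ := h1 h
    obtain ⟨y, hy⟩ := (C.toQuot_eq_zero c i a (u - v)).1 (by rw [map_sub, hv', sub_self])
    rw [← sub_add_cancel u v, ← hy]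
    exact Submodule.add_mem _ (C.x_mem_varSubmodule i _ ⟨0, by simp, by simp⟩ y) hv
  · intro h
    refine (varSubmodule_le ?_ : _ ≤ ((C.quot c).varSubmodule i a k).comap (C.toQuot c i a)) h
    intro b hb hj v
    rw [Submodule.mem_comap]
    rcases C.x_consDeg_cases _ hb hj v with ⟨v, hv⟩ | ⟨b', h', hj', v, hv⟩
    · rw [hv, (C.toQuot_eq_zero c i a _).2 ⟨v, rfl⟩]
      exact Submodule.zero_mem _
    · rw [hv, ← quot_x]
      exact (C.quot c).x_mem_varSubmodule i h' hj' _

theorem Regular.quot {C : GradedComplex.{u, w} K (n + 1)} (hC : C.Regular) (c : ℤ) :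
    (C.quot c).Regular := by
  intro i k a b h hj u hu
  obtain ⟨u, rfl⟩ := C.toQuot_surjective c i b u
  rw [quot_x, toQuot_mem_varSubmodule] at hu
  rw [toQuot_mem_varSubmodule]
  refine hC i (k + 1) _ _ (consDeg_le le_rfl h) (fun j => ?_) u hu
  refine Fin.cases (by simp) (fun j hjk => ?_) j
  simpa using hj j (by simpa using hjk)

/-- Each nonzerodivisor allows replacing a cone by a quotient. After all variables what is left is
the homology of the complex modulo the variables, written here by representatives. -/
theorem Regular.koszulRank_eq {C : GradedComplex.{u, w} K n} (hC : C.Regular) (a k) :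
    C.koszulRank a k =
      rk ((C.varSubmodule (k - 1 - 1) a n).comap (C.d (k - 1) a))
        (LinearMap.range (C.d k a) ⊔ C.varSubmodule (k - 1) a n) := by
  induction n with
  | zero => rw [varSubmodule_zero, varSubmodule_zero, sup_bot_eq]; rfl
  | succ n ih =>
    obtain ⟨c, a, rfl⟩ : ∃ c a', a = consDeg c a' := ⟨a 0, Fin.tail a, (Fin.cons_self_tail a).symm⟩
    rw [koszulRank_consDeg_of_injective _ _ _ _ fun i a => hC.x_injective i _, ih (hC.quot c)]
    symm
    refine rk_eq_of_map (C.toQuot c (k - 1) a) ?_ ?_ ?_ ?_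
    · intro z hz
      rw [Submodule.mem_comap, quot_d, toQuot_mem_varSubmodule]
      exact hz
    · intro z hz
      obtain ⟨_, ⟨y, rfl⟩, m, hm, rfl⟩ := Submodule.mem_sup.1 hz
      rw [map_add, ← quot_d]
      exact Submodule.add_mem_sup ⟨_, rfl⟩ ((C.toQuot_mem_varSubmodule c _ a n m).2 hm)
    · intro z hz
      obtain ⟨z, rfl⟩ := C.toQuot_surjective c _ a z
      rw [Submodule.mem_comap, quot_d, toQuot_mem_varSubmodule] at hz
      exact ⟨z, hz, by rw [sub_self]; exact Submodule.zero_mem _⟩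
    · intro z _ h
      obtain ⟨_, ⟨y, rfl⟩, m, hm, h⟩ := Submodule.mem_sup.1 h
      obtain ⟨y, rfl⟩ := C.toQuot_surjective c _ a y
      rw [quot_d] at h
      have : z - C.d k _ y ∈ C.varSubmodule (k - 1) (consDeg c a) (n + 1) := by
        rw [← toQuot_mem_varSubmodule, map_sub, ← h, add_sub_cancel_left]
        exact hm
      rw [← add_sub_cancel (C.d k _ y) z]
      exact Submodule.add_mem_sup ⟨_, rfl⟩ this

/-- A description of `varSubmodule` for free modules, in terms of coordinates. -/
theorem mem_varSubmodule_iff_of_coordinates {C : GradedComplex.{u, w} K n} {i : ℤ} {ι : Type w'}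
    (deg : ι → Fin n → ℤ) (e : ∀ a, C.obj i a →ₗ[K] (ι →₀ K))
    (he : ∀ a, Function.Injective (e a))
    (hx : ∀ {a b : Fin n → ℤ} (h : a ≤ b) u, e b (C.x i h u) = e a u)
    (hdeg : ∀ a u j, e a u j ≠ 0 → deg j ≤ a)
    (hsurj : ∀ j, ∃ u, e (deg j) u = Finsupp.single j 1) (a : Fin n → ℤ) (k : ℕ) (u) :
    u ∈ C.varSubmodule i a k ↔ ∀ j, e a u j ≠ 0 → ∃ l : Fin n, l.val < k ∧ deg j l < a l := by
  constructor
  · intro hu j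
    contrapose!
    intro hl
    have : C.varSubmodule i a k ≤ LinearMap.ker ((Finsupp.lapply j).comp (e a)) := by
      refine varSubmodule_le fun b hb ⟨l, hlk, hbl⟩ v => ?_
      by_contra hne
      have h1 : e b v j ≠ 0 := by rw [← hx hb]; exact hne
      exact absurd (hl l hlk) (not_le.2 ((hdeg b v j h1 l).trans_lt hbl))
    exact this hu
  · intro h
    choose s hs using hsurj
    have hle : ∀ j ∈ (e a u).support, deg j ≤ a := fun j hj => hdeg a u j (by simpa using hj)
    -- Every element is a combination of monomial multiples of basis elements; the condition on `l`
    -- makes each of these monomials divisible by one of the first `k` variables.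
    have h1 : u = ∑ j ∈ (e a u).support.attach, (e a u j.1) • C.x i (hle j.1 j.2) (s j.1) := by
      apply he
      rw [map_sum]
      simp only [map_smul, hx, hs, Finsupp.smul_single, smul_eq_mul, mul_one]
      rw [Finset.sum_attach (e a u).support (fun j => Finsupp.single j (e a u j))]
      exact (Finsupp.sum_single _).symm
    rw [h1]
    refine Submodule.sum_mem _ fun j _ => Submodule.smul_mem _ _ (C.x_mem_varSubmodule i _ ?_ _)
    exact h j.1 (Finsupp.mem_support_iff.1 j.2)

theorem regular_of_coordinates {C : GradedComplex.{u, w} K n}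
    (h : ∀ i : ℤ, ∃ (ι : Type w') (deg : ι → Fin n → ℤ) (e : ∀ a, C.obj i a →ₗ[K] (ι →₀ K)),
      (∀ a, Function.Injective (e a)) ∧
      (∀ {a b : Fin n → ℤ} (h : a ≤ b) u, e b (C.x i h u) = e a u) ∧
      (∀ a u j, e a u j ≠ 0 → deg j ≤ a) ∧ ∀ j, ∃ u, e (deg j) u = Finsupp.single j 1) :
    C.Regular := by
  intro i k a b hb hj u
  obtain ⟨ι, deg, e, he, hx, hdeg, hsurj⟩ := h i
  rw [mem_varSubmodule_iff_of_coordinates deg e he hx hdeg hsurj,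
    mem_varSubmodule_iff_of_coordinates deg e he hx hdeg hsurj, hx]
  intro h j hne
  obtain ⟨l, hl, hl'⟩ := h j hne
  exact ⟨l, hl, hl'.trans_eq (hj l hl).symm⟩

end GradedComplex

theorem totalDegree_lt {n : ℕ} {a b : Fin n → ℤ} (h : b ≤ a) (hj : ∃ j, b j < a j) :
    totalDegree b < totalDegree a :=
  Finset.sum_lt_sum (fun j _ => h j) (hj.imp fun j hj => ⟨Finset.mem_univ j, hj⟩)

/-! ### Modules as complexes, and their minimal free covers -/

namespace GradedComplex

variable {K : Type u} [Field K] {n : ℕ}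

/-- Complexes concentrated in homological degree `0`. -/
def IsModule (C : GradedComplex.{u, w} K n) : Prop := ∀ i ≠ 0, ∀ a, Subsingleton (C.obj i a)

/-- Complexes vanishing in all degrees `a` with `|a|` small. -/
def IsBounded (C : GradedComplex.{u, w} K n) : Prop :=
  ∃ c : ℤ, ∀ i a, totalDegree a ≤ c → Subsingleton (C.obj i a)

/-- Multiplication by monomials is injective. -/
def TorsionFree (C : GradedComplex.{u, w} K n) : Prop :=
  ∀ i {a b : Fin n → ℤ} (h : a ≤ b), Function.Injective (C.x i h)

theorem IsModule.d_eq_zero {C : GradedComplex.{u, w} K n} (hC : C.IsModule) (i a u) :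
    C.d i a u = 0 := by
  by_cases hi : i = 0
  · have := hC (i - 1) (by omega) a
    exact Subsingleton.elim _ _
  · have := hC i hi a
    rw [Subsingleton.elim u 0, map_zero]

theorem IsModule.slice {C : GradedComplex.{u, w} K (n + 1)} (hC : C.IsModule) (c : ℤ) :
    (C.slice c).IsModule := fun i hi a => hC i hi (consDeg c a)

theorem IsModule.quot {C : GradedComplex.{u, w} K (n + 1)} (hC : C.IsModule) (c : ℤ) :
    (C.quot c).IsModule := fun i hi a => by
  have := hC i hi (consDeg c a)
  exact (C.toQuot_surjective c i a).subsingleton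

theorem IsBounded.slice {C : GradedComplex.{u, w} K (n + 1)} (hC : C.IsBounded) (c : ℤ) :
    (C.slice c).IsBounded := by
  obtain ⟨c₀, h⟩ := hC
  refine ⟨c₀ - c, fun i a ha => h i (consDeg c a) ?_⟩
  rw [totalDegree_consDeg]
  omega

theorem IsBounded.quot {C : GradedComplex.{u, w} K (n + 1)} (hC : C.IsBounded) (c : ℤ) :
    (C.quot c).IsBounded := by
  obtain ⟨c₀, h⟩ := hC.slice c
  refine ⟨c₀, fun i a ha => ?_⟩
  have := h i a ha
  exact (C.toQuot_surjective c i a).subsingleton (α := (C.slice c).obj i a)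

theorem TorsionFree.slice {C : GradedComplex.{u, w} K (n + 1)} (hC : C.TorsionFree) (c : ℤ) :
    (C.slice c).TorsionFree := fun i _ _ _ => hC i _

/-! ### Minimal free covers -/

section Cover

variable (M : GradedComplex.{u, max u v} K n)

/-- The index set of a minimal system of homogeneous generators. -/
abbrev GenIndex (i : ℤ) : Type (max u v) :=
  Σ a : Fin n → ℤ, Module.Basis.ofVectorSpaceIndex K (M.obj i a ⧸ M.varSubmodule i a n)

/-- A minimal system of homogeneous generators. -/
def gen (i : ℤ) (j : M.GenIndex i) : M.obj i j.1 :=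
  (Submodule.mkQ_surjective (M.varSubmodule i j.1 n)
    (Module.Basis.ofVectorSpace K (M.obj i j.1 ⧸ M.varSubmodule i j.1 n) j.2)).choose

theorem mkQ_gen (i : ℤ) (j : M.GenIndex i) : (M.varSubmodule i j.1 n).mkQ (M.gen i j) =
    Module.Basis.ofVectorSpace K (M.obj i j.1 ⧸ M.varSubmodule i j.1 n) j.2 :=
  (Submodule.mkQ_surjective (M.varSubmodule i j.1 n)
    (Module.Basis.ofVectorSpace K (M.obj i j.1 ⧸ M.varSubmodule i j.1 n) j.2)).choose_spec

/-- The free module on a minimal system of homogeneous generators. -/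
def freeCover : GradedComplex.{u, max u v} K n where
  -- In degree `a` each generator of degree at most `a` has exactly one monomial multiple, so
  -- multiplication by monomials leaves coordinates unchanged.
  obj i a := Finsupp.supported K K {j : M.GenIndex i | j.1 ≤ a}
  d _ _ := 0
  x _ _ _ h := Submodule.inclusion (Finsupp.supported_mono fun _ hj => le_trans hj h)
  d_d _ _ _ := rfl
  d_x _ _ _ _ _ := (map_zero _).symm
  x_refl _ _ _ := rfl
  x_x _ _ _ _ _ _ _ := rfl

open Classical in
/-- The value on basis elements of the map from the free module to the module. -/
def genAt (i : ℤ) (a : Fin n → ℤ) (j : M.GenIndex i) : M.obj i a :=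
  if h : j.1 ≤ a then M.x i h (M.gen i j) else 0

/-- The map from the free module. -/
def coverMap (i : ℤ) (a : Fin n → ℤ) : (M.freeCover).obj i a →ₗ[K] M.obj i a :=
  (Finsupp.linearCombination K (M.genAt i a)).comp (Submodule.subtype _)

theorem coverMap_x (i) {a b : Fin n → ℤ} (h : a ≤ b) (u) :
    M.coverMap i b (M.freeCover.x i h u) = M.x i h (M.coverMap i a u) := by
  change Finsupp.linearCombination K (M.genAt i b) u.1 =
    M.x i h (Finsupp.linearCombination K (M.genAt i a) u.1)
  rw [Finsupp.linearCombination_apply, Finsupp.linearCombination_apply, map_finsuppSum]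
  refine Finsupp.sum_congr fun j hj => ?_
  have hja : j.1 ≤ a := u.2 hj
  rw [map_smul, genAt, genAt, dif_pos hja, dif_pos (hja.trans h), M.x_x]

/-- Modulo the variables, generators of degree different from `j.1` vanish and those of degree `j.1`
form a basis. Thus the coordinate at `j` can be recovered from the image in `M`. -/
theorem coord_linearCombination_genAt (i : ℤ) (j : M.GenIndex i) :
    ((Module.Basis.ofVectorSpace K (M.obj i j.1 ⧸ M.varSubmodule i j.1 n)).coord j.2).comp
      ((M.varSubmodule i j.1 n).mkQ.comp (Finsupp.linearCombination K (M.genAt i j.1))) =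
    Finsupp.lapply j := by
  classical
  obtain ⟨a, j⟩ := j
  refine Finsupp.lhom_ext' fun j' => LinearMap.ext_ring ?_
  obtain ⟨b, j'⟩ := j'
  simp only [LinearMap.comp_apply, Finsupp.lsingle_apply, Finsupp.linearCombination_single,
    one_smul, Finsupp.lapply_apply]
  by_cases hb : b = a
  · subst hb
    rw [genAt, dif_pos le_rfl, M.x_refl, M.mkQ_gen i ⟨b, j'⟩, Module.Basis.coord_apply,
      Module.Basis.repr_self, Finsupp.single_apply, Finsupp.single_apply]
    simp
  · have h0 : (M.varSubmodule i a n).mkQ (M.genAt i a ⟨b, j'⟩) = 0 := by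
      rw [Submodule.mkQ_apply, Submodule.Quotient.mk_eq_zero, genAt]
      split_ifs with h
      · refine M.x_mem_varSubmodule i h ?_ _
        by_contra! hl
        exact hb (le_antisymm h fun l => hl l l.2)
      · exact Submodule.zero_mem _
    rw [h0, map_zero, Finsupp.single_eq_of_ne]
    rintro ⟨⟩
    exact hb rfl

/-- Graded Nakayama, by induction on `|a|` starting below the bound. -/
theorem eq_top_of_sup_varSubmodule_eq_top (hM : M.IsBounded) (i : ℤ)
    (R : ∀ a, Submodule K (M.obj i a))
    (hR : ∀ (a b : Fin n → ℤ) (h : a ≤ b), ∀ u ∈ R a, M.x i h u ∈ R b)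
    (h : ∀ a, R a ⊔ M.varSubmodule i a n = ⊤) (a) : R a = ⊤ := by
  obtain ⟨c, hc⟩ := hM
  have key : ∀ m : ℕ, ∀ a, totalDegree a ≤ c + m → R a = ⊤ := by
    intro m
    induction m with
    | zero =>
      intro a ha
      have := hc i a (by simpa using ha)
      exact Subsingleton.elim _ _
    | succ m ih =>
      intro a ha
      rw [← h a, eq_comm, sup_eq_left]
      refine varSubmodule_le fun b hb ⟨j, _, hj⟩ u => hR b a hb u ?_
      have := totalDegree_lt hb ⟨j, hj⟩
      rw [ih b (by push_cast at ha; omega)]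
      trivial
  exact key (totalDegree a - c).toNat a (by omega)

theorem coverMap_surjective (hM : M.IsBounded) (i a) : Function.Surjective (M.coverMap i a) := by
  rw [← LinearMap.range_eq_top]
  refine M.eq_top_of_sup_varSubmodule_eq_top hM i (fun a => LinearMap.range (M.coverMap i a)) ?_ ?_ a
  · rintro a b h _ ⟨u, rfl⟩
    exact ⟨_, M.coverMap_x i h u⟩
  · intro a
    rw [eq_top_iff]
    intro m _
    have h1 : (⊤ : Submodule K (M.obj i a ⧸ M.varSubmodule i a n)) ≤
        (LinearMap.range (M.coverMap i a)).map (M.varSubmodule i a n).mkQ := by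
      rw [← (Module.Basis.ofVectorSpace K (M.obj i a ⧸ M.varSubmodule i a n)).span_eq,
        Submodule.span_le]
      rintro _ ⟨j, rfl⟩
      refine ⟨_, ⟨⟨Finsupp.single ⟨a, j⟩ 1, Finsupp.single_mem_supported K 1 (le_refl a)⟩, rfl⟩, ?_⟩
      rw [← M.mkQ_gen i ⟨a, j⟩]
      change (M.varSubmodule i a n).mkQ (Finsupp.linearCombination K (M.genAt i a)
        (Finsupp.single ⟨a, j⟩ 1)) = (M.varSubmodule i a n).mkQ (M.gen i ⟨a, j⟩)
      rw [Finsupp.linearCombination_single, one_smul, genAt, dif_pos le_rfl, M.x_refl]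
    obtain ⟨r, hr, hr'⟩ := h1 (Submodule.mem_top (x := (M.varSubmodule i a n).mkQ m))
    rw [← add_sub_cancel r m]
    refine Submodule.add_mem_sup hr ?_
    rw [← Submodule.Quotient.mk_eq_zero, ← Submodule.mkQ_apply, map_sub, hr', sub_self]

/-- The first syzygy module. -/
def syzygy : GradedComplex.{u, max u v} K n where
  obj i a := LinearMap.ker (M.coverMap i a)
  d i a := 0
  x i a b h := (M.freeCover.x i h).restrict fun u hu => by
    rw [LinearMap.mem_ker] at hu ⊢
    rw [coverMap_x, hu, map_zero]
  d_d _ _ _ := rfl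
  d_x _ _ _ _ _ := (map_zero _).symm
  x_refl _ _ _ := rfl
  x_x _ _ _ _ _ _ _ := rfl

variable {M}

/-- The short exact sequence of a minimal free cover. -/
def coverSeq (h : M.IsModule) (hM : M.IsBounded) : ShortExactSeq M.syzygy M.freeCover M where
  f i a := Submodule.subtype _
  g := M.coverMap
  f_d _ _ _ := rfl
  g_d i a u := by rw [h.d_eq_zero]; exact map_zero _
  f_x _ _ _ _ _ := rfl
  g_x i _ _ h u := M.coverMap_x i h u
  f_injective _ _ := Subtype.val_injective
  g_surjective := M.coverMap_surjective hM
  g_f _ _ u := u.2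
  exact _ _ v hv := ⟨⟨v, hv⟩, rfl⟩

theorem isModule_freeCover (h : M.IsModule) : M.freeCover.IsModule := by
  intro i hi a
  have hj : IsEmpty (M.GenIndex i) := by
    refine ⟨fun j => ?_⟩
    have := h i hi j.1
    have := (Submodule.mkQ_surjective (M.varSubmodule i j.1 n)).subsingleton
    exact (Module.Basis.ofVectorSpace K (M.obj i j.1 ⧸ M.varSubmodule i j.1 n)).ne_zero j.2
      (Subsingleton.elim _ _)
  exact ⟨fun u v => Subtype.ext (Subsingleton.elim _ _)⟩

theorem isModule_syzygy (h : M.IsModule) : M.syzygy.IsModule := by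
  intro i hi a
  have := isModule_freeCover h i hi a
  exact ⟨fun u v => Subtype.ext (Subsingleton.elim _ _)⟩

theorem isBounded_syzygy (hM : M.IsBounded) : M.syzygy.IsBounded := by
  obtain ⟨c, hc⟩ := hM
  refine ⟨c, fun i a ha => ?_⟩
  have h0 : ∀ u : M.freeCover.obj i a, u = 0 := by
    intro u
    refine Subtype.ext (Finsupp.ext fun j => ?_)
    by_contra hne
    have hj : j.1 ≤ a := u.2 (Finsupp.mem_support_iff.2 hne)
    have := hc i j.1 ((Finset.sum_le_sum fun l _ => hj l).trans ha)
    have := (Submodule.mkQ_surjective (M.varSubmodule i j.1 n)).subsingleton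
    exact (Module.Basis.ofVectorSpace K (M.obj i j.1 ⧸ M.varSubmodule i j.1 n)).ne_zero j.2
      (Subsingleton.elim _ _)
  exact ⟨fun u v => Subtype.ext ((h0 _).trans (h0 _).symm)⟩

theorem torsionFree_syzygy : M.syzygy.TorsionFree := by
  intro i a b h u v huv
  have h1 : (M.freeCover.x i h u.1).1 = (M.freeCover.x i h v.1).1 :=
    congrArg (fun y => y.1.1) huv
  exact Subtype.ext (Subtype.ext h1)

theorem mem_varSubmodule_freeCover (i a) (u : M.freeCover.obj i a) (k : ℕ) :
    u ∈ M.freeCover.varSubmodule i a k ↔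
      ∀ j, u.1 j ≠ 0 → ∃ l : Fin n, l.val < k ∧ j.1 l < a l :=
  mem_varSubmodule_iff_of_coordinates (C := M.freeCover) (fun j : M.GenIndex i => j.1)
    (fun a => Submodule.subtype (Finsupp.supported K K {j : M.GenIndex i | j.1 ≤ a}))
    (fun _ => Subtype.val_injective) (fun _ _ => rfl)
    (fun _ u _ hj => u.2 (Finsupp.mem_support_iff.2 hj))
    (fun j => ⟨⟨Finsupp.single j 1, Finsupp.single_mem_supported K 1 (le_refl j.1)⟩, rfl⟩) a k u

theorem regular_freeCover : M.freeCover.Regular :=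
  regular_of_coordinates fun i => ⟨M.GenIndex i, fun j => j.1,
    fun a => Submodule.subtype (Finsupp.supported K K {j : M.GenIndex i | j.1 ≤ a}),
    fun _ => Subtype.val_injective, fun _ _ => rfl,
    fun _ u _ hj => u.2 (Finsupp.mem_support_iff.2 hj),
    fun j => ⟨⟨Finsupp.single j 1, Finsupp.single_mem_supported K 1 (le_refl j.1)⟩, rfl⟩⟩

/-- Minimality of the cover: a coordinate at a generator of degree exactly `a` is determined by the
image in `M`, which is zero. -/
theorem syzygy_le_varSubmodule (i a) (u : M.syzygy.obj i a) :
    u.1 ∈ M.freeCover.varSubmodule i a n := by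
  rw [mem_varSubmodule_freeCover]
  intro j hj
  by_contra! hl
  have hja : j.1 ≤ a := u.1.2 (Finsupp.mem_support_iff.2 hj)
  obtain ⟨b, j⟩ := j
  obtain rfl : b = a := le_antisymm hja fun l => hl l l.2
  apply hj
  have h1 := LinearMap.congr_fun (M.coord_linearCombination_genAt i ⟨b, j⟩) u.1.1
  have h2 : Finsupp.linearCombination K (M.genAt i b) u.1.1 = 0 := u.2
  rw [LinearMap.comp_apply, LinearMap.comp_apply, h2, map_zero, map_zero] at h1
  exact h1.symm

theorem koszulRank_freeCover (h : M.IsModule) (a) (i : ℤ) (hi : i ≠ 0) :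
    M.freeCover.koszulRank a (i + 1) = 0 := by
  rw [regular_freeCover.koszulRank_eq]
  have := isModule_freeCover h (i + 1 - 1) (by omega) a
  exact rk_eq_zero _ _

theorem koszulRank_syzygy_le (h : M.IsModule) (hM : M.IsBounded) (a) (i : ℕ) :
    M.syzygy.koszulRank a (i + 1) ≤ M.koszulRank a ((i + 1 : ℕ) + 1) := by
  have e : (i : ℤ) + 1 = ((i + 1 : ℕ) : ℤ) + 1 - 1 := by push_cast; ring
  rw [e]
  -- For `i = 0` the free cover has homology, and minimality is needed to discard it; for `i > 0`
  -- its homology vanishes.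
  rcases Nat.eq_zero_or_pos i with rfl | hi
  · refine (coverSeq h hM).koszulRank_left_le_of_minimal a _
      (fun i hi b => isModule_syzygy h i (by push_cast at hi; omega) b)
      (fun i hi b => isModule_freeCover h i (by push_cast at hi; omega) b)
      fun b u => Submodule.mem_sup_right (syzygy_le_varSubmodule _ b u)
  · refine ((coverSeq h hM).koszulRank_left_le a _).trans ?_
    rw [← e, koszulRank_freeCover h a i (by omega), add_zero]

theorem koszulRank_syzygy_ne_zero (h : M.IsModule) (hM : M.IsBounded) (a) (i : ℕ)
    (hi : M.koszulRank a ((i + 1 : ℕ) + 1) ≠ 0) : M.syzygy.koszulRank a (i + 1) ≠ 0 := by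
  intro h0
  have h1 := (coverSeq h hM).koszulRank_right_le a ((i + 1 : ℕ) + 1)
  rw [koszulRank_freeCover h a _ (by omega), zero_add, add_sub_cancel_right, Nat.cast_succ, h0] at h1
  exact hi (le_zero_iff.1 h1)

end Cover

/-! ### Lower bounds -/

/-- The Betti numbers `β_{i,b}` with `b ≤ a` and `|b| ≤ m` add up to at least `N`. -/
def BettiBound (M : GradedComplex.{u, w} K n) (i : ℕ) (a : Fin n → ℤ) (m : ℤ) (N : ℕ) : Prop :=
  ∃ T : Finset (Fin n → ℤ), (∀ b ∈ T, b ≤ a ∧ totalDegree b ≤ m) ∧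
    (N : Cardinal) ≤ ∑ b ∈ T, M.koszulRank b (i + 1)

theorem bettiBound_zero (M : GradedComplex.{u, w} K n) (i a m) : M.BettiBound i a m 0 :=
  ⟨∅, by simp, by simp⟩

theorem bettiBound_one {M : GradedComplex.{u, w} K n} {i : ℕ} {a b : Fin n → ℤ} {m : ℤ}
    (hba : b ≤ a) (hm : totalDegree b ≤ m) (h : M.koszulRank b (i + 1) ≠ 0) :
    M.BettiBound i a m 1 :=
  ⟨{b}, by simpa using ⟨hba, hm⟩, by simpa [Cardinal.one_le_iff_ne_zero] using h⟩

/-- Nonzero Koszul homology at position `p` requires a nonzero `M_b` with `b ≤ a` and `|b| = |a| -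
p`. Descending from `b`, which stops by boundedness, reaches a degree all of whose elements are
minimal generators. -/
theorem bettiBound_zero_of_koszulRank_ne_zero {M : GradedComplex.{u, w} K n} (h : M.IsModule)
    (hM : M.IsBounded) (p : ℕ) (a : Fin n → ℤ) (hp : M.koszulRank a (p + 1) ≠ 0) :
    M.BettiBound 0 a (totalDegree a - p) 1 := by
  obtain ⟨b, hba, hbd, hb⟩ : ∃ b ≤ a, totalDegree b ≤ totalDegree a - p ∧ Nontrivial (M.obj 0 b) := by
    by_contra! hne
    refine hp (M.koszulRank_eq_zero a p fun i b hb hd => ?_)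
    by_cases hi : i = 0
    · subst hi
      exact hne b hb (by omega)
    · exact h i hi b
  obtain ⟨c, hc⟩ := hM
  have key : ∀ m : ℕ, ∀ b ≤ a, totalDegree b ≤ totalDegree a - p → totalDegree b ≤ c + m →
      Nontrivial (M.obj 0 b) → M.BettiBound 0 a (totalDegree a - p) 1 := by
    intro m
    induction m with
    | zero =>
      intro b _ _ hb hn
      have := hc 0 b (by simpa using hb)
      exact absurd hn (not_nontrivial _)
    | succ m ih =>
      intro b hba hbd hbm hn
      by_cases hex : ∃ b' ≤ b, b' ≠ b ∧ Nontrivial (M.obj 0 b')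
      · obtain ⟨b', hb', hne, hn'⟩ := hex
        have hlt := totalDegree_lt hb' (by
          by_contra! hl
          exact hne (le_antisymm hb' hl))
        exact ih b' (hb'.trans hba) (by omega) (by push_cast at hbm; omega) hn'
      · push Not at hex
        exact bettiBound_one hba hbd (M.koszulRank_ne_zero b _
          (fun i hi b => h i (by simp at hi; omega) b) hn
          (h _ (by simp) b) fun b' hb' hne => hex b' hb' hne)
  exact key (totalDegree b - c).toNat b hba hbd (by omega) hb

/-- The sequences `0 → M_{e-1} → M_e → Q_e → 0` peel off one layer at a time, until boundedness
makes the remaining slice irrelevant in degree `b`. -/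
theorem koszulRank_slice_le {M : GradedComplex.{u, w} K (n + 1)}
    (hM : M.IsBounded) (ht : M.TorsionFree) (b : Fin n → ℤ) (k c : ℤ) :
    ∃ c₀, (M.slice c).koszulRank b k ≤
      ∑ e ∈ Finset.Ioc c₀ c, M.koszulRank (consDeg e b) k := by
  obtain ⟨m, hm⟩ := hM
  have key : ∀ N : ℕ, (M.slice c).koszulRank b k ≤ (M.slice (c - N)).koszulRank b k +
      ∑ e ∈ Finset.Ioc (c - N) c, M.koszulRank (consDeg e b) k := by
    intro N
    induction N with
    | zero => simp
    | succ N ih =>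
      have h1 := (M.sliceSeq (c - N) fun i a => ht i _).koszulRank_middle_le b k
      rw [← M.koszulRank_consDeg_of_injective (c - N) b k fun i a => ht i _] at h1
      have e1 : c - (N : ℤ) - 1 = c - (N + 1 : ℕ) := by push_cast; ring
      have e2 : Finset.Ioc (c - (N + 1 : ℕ)) c = insert (c - (N : ℤ)) (Finset.Ioc (c - N) c) := by
        ext e
        simp only [Finset.mem_Ioc, Finset.mem_insert]
        push_cast
        omega
      rw [e1] at h1
      rw [e2, Finset.sum_insert (by simp), ← add_assoc]
      exact ih.trans (add_le_add_left h1 _)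
  obtain ⟨N, hN⟩ : ∃ N : ℕ, c - N + totalDegree b ≤ m :=
    ⟨(c + totalDegree b - m).toNat, by omega⟩
  refine ⟨c - N, (key N).trans ?_⟩
  have h0 : (M.slice (c - N)).koszulRank b k = 0 := by
    have := (M.slice (c - N)).koszulRank_eq_zero b (k - 1) fun i b' hb' _ => hm i _ (by
      rw [totalDegree_consDeg]
      have : totalDegree b' ≤ totalDegree b := Finset.sum_le_sum fun l _ => hb' l
      omega)
    rwa [sub_add_cancel] at this
  rw [h0, zero_add]

theorem BettiBound.of_slice {M : GradedComplex.{u, w} K (n + 1)} (hM : M.IsBounded)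
    (ht : M.TorsionFree) {i : ℕ} {a : Fin n → ℤ} {c m : ℤ} {N : ℕ}
    (h : (M.slice c).BettiBound i a m N) :
    ∃ T : Finset (Fin (n + 1) → ℤ), (∀ b ∈ T, b ≤ consDeg c a ∧ totalDegree b ≤ c + m) ∧
      (N : Cardinal) ≤ ∑ b ∈ T, M.koszulRank b (i + 1) := by
  classical
  obtain ⟨T, h1, h2⟩ := h
  choose c₀ hc₀ using fun b => koszulRank_slice_le hM ht b (i + 1) c
  refine ⟨(T.sigma fun b => Finset.Ioc (c₀ b) c).map
    ⟨fun x => consDeg x.2 x.1, ?_⟩, ?_, ?_⟩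
  · rintro ⟨b, e⟩ ⟨b', e'⟩ hbb
    obtain ⟨rfl, rfl⟩ := Fin.cons_inj.1 hbb
    rfl
  · intro b hb
    simp only [Finset.mem_map, Finset.mem_sigma, Finset.mem_Ioc] at hb
    obtain ⟨⟨b, e⟩, ⟨hbT, -, he⟩, rfl⟩ := hb
    refine ⟨consDeg_le he (h1 b hbT).1, ?_⟩
    change totalDegree (consDeg e b) ≤ _
    rw [totalDegree_consDeg]
    exact add_le_add he (h1 b hbT).2
  · rw [Finset.sum_map, Finset.sum_sigma]
    exact h2.trans (Finset.sum_le_sum fun b _ => hc₀ b)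

theorem BettiBound.of_quot {M : GradedComplex.{u, w} K (n + 1)} (ht : M.TorsionFree)
    {i : ℕ} {a : Fin n → ℤ} {c m : ℤ} {N : ℕ} (h : (M.quot c).BettiBound i a m N) :
    ∃ T : Finset (Fin (n + 1) → ℤ), (∀ b ∈ T, b 0 = c ∧ b ≤ consDeg c a ∧ totalDegree b ≤ c + m) ∧
      (N : Cardinal) ≤ ∑ b ∈ T, M.koszulRank b (i + 1) := by
  obtain ⟨T, h1, h2⟩ := h
  refine ⟨T.map ⟨fun b => consDeg c b, fun b b' h => (Fin.cons_inj.1 h).2⟩, ?_, ?_⟩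
  · intro b hb
    obtain ⟨b, hbT, rfl⟩ := Finset.mem_map.1 hb
    refine ⟨rfl, consDeg_le le_rfl (h1 b hbT).1, ?_⟩
    change totalDegree (consDeg c b) ≤ _
    rw [totalDegree_consDeg]
    exact add_le_add le_rfl (h1 b hbT).2
  · rw [Finset.sum_map]
    refine h2.trans_eq (Finset.sum_congr rfl fun b _ => ?_)
    exact (M.koszulRank_consDeg_of_injective c b _ fun i a => ht i _).symm

/-- The bound for modules follows from the bound for their first syzygies. -/
theorem bettiBound_of_syzygy (M : GradedComplex.{u, max u v} K n) (h : M.IsModule)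
    (hM : M.IsBounded)
    (ih : ∀ (p : ℕ) (a : Fin n → ℤ), M.syzygy.koszulRank a (p + 1) ≠ 0 →
      ∀ i : ℕ, M.syzygy.BettiBound i a (totalDegree a - p + i) ((p + 1).choose (i + 1)))
    (p : ℕ) (a : Fin n → ℤ) (hp : M.koszulRank a (p + 1) ≠ 0) (i : ℕ) :
    M.BettiBound i a (totalDegree a - p + i) (p.choose i) := by
  cases i with
  | zero =>
    rw [Nat.choose_zero_right, Nat.cast_zero, add_zero]
    exact bettiBound_zero_of_koszulRank_ne_zero h hM p a hp
  | succ i =>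
    -- Passing to the syzygy module lowers `p` and `i` together, so `|a| - p + i` is unchanged; for
    -- `p = 0` the binomial coefficient is zero.
    cases p with
    | zero => exact bettiBound_zero _ _ _ _
    | succ p =>
      obtain ⟨T, h1, h2⟩ := ih p a (koszulRank_syzygy_ne_zero h hM a p hp) i
      refine ⟨T, fun b hb => ⟨(h1 b hb).1, ?_⟩, h2.trans ?_⟩
      · have := (h1 b hb).2
        push_cast
        omega
      · exact Finset.sum_le_sum fun b _ => koszulRank_syzygy_le h hM b i

theorem bettiBound_of_torsionFree (M : GradedComplex.{u, max u v} K n) (h : M.IsModule)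
    (hM : M.IsBounded) (ht : M.TorsionFree) (p : ℕ) (a : Fin n → ℤ)
    (hp : M.koszulRank a (p + 1) ≠ 0) (i : ℕ) :
    M.BettiBound i a (totalDegree a - p + i) ((p + 1).choose (i + 1)) := by
  induction n generalizing p i with
  | zero =>
    -- Without variables all degrees have `|a| = 0`, so there is homology only at position `0`.
    obtain rfl : p = 0 := by
      by_contra hne
      refine hp (M.koszulRank_eq_zero a p fun i b _ hd => h i ?_ b)
      simp only [totalDegree, Finset.univ_eq_empty, Finset.sum_empty] at hd
      omega
    cases i with
    | zero => exact bettiBound_one le_rfl (by simp) hp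
    | succ i =>
      rw [Nat.choose_eq_zero_of_lt (by omega)]
      exact bettiBound_zero _ _ _ _
  | succ n ih =>
    classical
    obtain ⟨c, a, rfl⟩ : ∃ c a', a = consDeg c a' := ⟨a 0, Fin.tail a, (Fin.cons_self_tail a).symm⟩
    by_cases hs : (M.slice c).koszulRank a (p + 1) = 0
    · have hq : (M.quot c).koszulRank a (p + 1) ≠ 0 := by
        rwa [← M.koszulRank_consDeg_of_injective c a _ fun i a => ht i _]
      -- The homology of the quotient at position `p` cannot come from the slice `c`, so the
      -- connecting homomorphism sends it to position `p - 1` of the slice `c - 1`.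
      have hs' : (M.slice (c - 1)).koszulRank a p ≠ 0 := by
        intro h0
        have h1 := (M.sliceSeq c fun i a => ht i _).koszulRank_right_le a (p + 1)
        rw [hs, add_sub_cancel_right, h0, add_zero] at h1
        exact hq (le_zero_iff.1 h1)
      cases p with
      | zero =>
        refine absurd ((M.slice (c - 1)).koszulRank_eq_zero a (-1) fun i b hb hd => ?_) (by simpa using hs')
        refine h.slice (c - 1) i ?_ b
        have : totalDegree b ≤ totalDegree a := Finset.sum_le_sum fun l _ => hb l
        omega
      | succ p =>
        obtain ⟨T₁, h1, h1'⟩ := (ih _ (h.slice _) (hM.slice _) (ht.slice _) p a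
          (by simpa using hs') i).of_slice hM ht
        -- The quotient need not be torsion free, so the induction hypothesis is applied to its
        -- syzygy module.
        obtain ⟨T₂, h2, h2'⟩ := (bettiBound_of_syzygy (M.quot c) (h.quot c) (hM.quot c)
          (ih _ (isModule_syzygy (h.quot c)) (isBounded_syzygy (hM.quot c)) torsionFree_syzygy)
          (p + 1) a hq i).of_quot ht
        -- The two families differ in the first coordinate: at most `c - 1` against exactly `c`.
        have hdisj : Disjoint T₁ T₂ := by
          rw [Finset.disjoint_left]
          intro b hb1 hb2
          have h3 : b 0 ≤ c - 1 := (h1 b hb1).1 0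
          have h4 := (h2 b hb2).1
          omega
        refine ⟨T₁ ∪ T₂, fun b hb => ?_, ?_⟩
        · rw [totalDegree_consDeg]
          rcases Finset.mem_union.1 hb with hb | hb
          · refine ⟨(h1 b hb).1.trans (consDeg_le (by omega) le_rfl), ?_⟩
            have := (h1 b hb).2
            push_cast
            omega
          · refine ⟨(h2 b hb).2.1, ?_⟩
            have := (h2 b hb).2.2
            omega
        · rw [Finset.sum_union hdisj, Nat.choose_succ_succ, Nat.cast_add, add_comm]
          exact add_le_add h1' h2'
    · obtain ⟨T, h1, h2⟩ :=
        (ih (M.slice c) (h.slice c) (hM.slice c) (ht.slice c) p a hs i).of_slice hM ht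
      refine ⟨T, fun b hb => ⟨(h1 b hb).1, ?_⟩, h2⟩
      rw [totalDegree_consDeg]
      have := (h1 b hb).2
      omega

end GradedComplex

/-! ### Graded free resolutions -/

/-! ### Monomials and coordinates on graded free modules -/

section Monomials

variable {K : Type u} [Field K] {n : ℕ}

theorem weight_varDegree (m : Fin n →₀ ℕ) :
    Finsupp.weight (varDegree n) m = fun l => (m l : ℤ) := by
  ext l
  simp [Finsupp.weight_apply, Finsupp.sum_fintype, varDegree, Finset.sum_apply, Pi.single_apply]

/-- The exponent of degree `a`. -/
def exponent (a : Fin n → ℤ) : Fin n →₀ ℕ := Finsupp.equivFunOnFinite.symm fun l => (a l).toNat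

theorem exponent_apply (a : Fin n → ℤ) (l : Fin n) : exponent a l = (a l).toNat := rfl

variable (K) in
/-- The monomial of degree `b - a`. -/
def shiftMonomial (a b : Fin n → ℤ) : MvPolynomial (Fin n) K :=
  MvPolynomial.monomial (exponent (b - a)) 1

theorem shiftMonomial_mem {a b : Fin n → ℤ} (h : a ≤ b) :
    shiftMonomial K a b ∈ polyGrading K n (b - a) := by
  refine MvPolynomial.isWeightedHomogeneous_monomial _ _ _ ?_
  rw [weight_varDegree]
  ext l
  have : a l ≤ b l := h l
  simp only [exponent_apply, Pi.sub_apply]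
  omega

theorem shiftMonomial_self (a : Fin n → ℤ) : shiftMonomial K a a = 1 := by
  have : exponent (a - a) = 0 := by
    ext l
    simp [exponent_apply]
  rw [shiftMonomial, this]
  rfl

theorem shiftMonomial_mul {a b c : Fin n → ℤ} (h : a ≤ b) (h' : b ≤ c) :
    shiftMonomial K b c * shiftMonomial K a b = shiftMonomial K a c := by
  have he : exponent (c - b) + exponent (b - a) = exponent (c - a) := by
    ext l
    have : a l ≤ b l := h l
    have : b l ≤ c l := h' l
    simp only [exponent_apply, Pi.sub_apply, Finsupp.add_apply]
    omega
  rw [shiftMonomial, shiftMonomial, shiftMonomial, MvPolynomial.monomial_mul, one_mul, he]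

/-- Each degree in `ℤ^n` contains at most one monomial. This is why `sumCoeff` is injective on
homogeneous polynomials of a fixed degree and serves as a coordinate. -/
theorem exists_eq_monomial {b : Fin n → ℤ} {p : MvPolynomial (Fin n) K}
    (hp : p ∈ polyGrading K n b) :
    ∃ c, p = MvPolynomial.monomial (exponent b) c ∧ (p ≠ 0 → 0 ≤ b) := by
  have key : ∀ m, MvPolynomial.coeff m p ≠ 0 → ∀ l, (m l : ℤ) = b l := by
    intro m hm l
    have h := hp hm
    rw [weight_varDegree] at h
    exact congrFun h l
  refine ⟨MvPolynomial.coeff (exponent b) p, ?_, ?_⟩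
  · ext m
    rw [MvPolynomial.coeff_monomial]
    split_ifs with h
    · rw [h]
    · by_contra hne
      apply h
      ext l
      rw [exponent_apply, ← key m hne l, Int.toNat_natCast]
  · intro h0 l
    obtain ⟨m, hm⟩ := MvPolynomial.ne_zero_iff.1 h0
    rw [← key m hm l]
    exact Int.natCast_nonneg _

variable (K n) in
/-- The sum of the coefficients. -/
def sumCoeff : MvPolynomial (Fin n) K →ₐ[K] K := MvPolynomial.aeval fun _ => 1

theorem sumCoeff_monomial (m : Fin n →₀ ℕ) (c : K) :
    sumCoeff K n (MvPolynomial.monomial m c) = c := by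
  simp [sumCoeff, MvPolynomial.aeval_monomial]

theorem eq_zero_of_sumCoeff_eq_zero {b : Fin n → ℤ} {p : MvPolynomial (Fin n) K}
    (hp : p ∈ polyGrading K n b) (h : sumCoeff K n p = 0) : p = 0 := by
  obtain ⟨c, rfl, -⟩ := exists_eq_monomial hp
  rw [sumCoeff_monomial] at h
  rw [h, map_zero]

/-- The ideal `(X_1, …, X_n)`. -/
abbrev varIdeal (K : Type u) [Field K] (n : ℕ) : Ideal (MvPolynomial (Fin n) K) :=
  Ideal.span (Set.range (MvPolynomial.X : Fin n → MvPolynomial (Fin n) K))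

theorem eq_zero_of_mem_varIdeal {p : MvPolynomial (Fin n) K} (hp : p ∈ polyGrading K n 0)
    (h : p ∈ varIdeal K n) : p = 0 := by
  obtain ⟨c, rfl, -⟩ := exists_eq_monomial hp
  have h0 : exponent (0 : Fin n → ℤ) = 0 := by
    ext l
    simp [exponent_apply]
  have hle : varIdeal K n ≤ RingHom.ker (MvPolynomial.constantCoeff : MvPolynomial (Fin n) K →+* K) := by
    rw [Ideal.span_le]
    rintro _ ⟨l, rfl⟩
    simp
  have h1 := hle h
  rw [RingHom.mem_ker, h0, MvPolynomial.constantCoeff_monomial, if_pos rfl] at h1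
  rw [h1, map_zero]

theorem shiftMonomial_mem_varIdeal {a b : Fin n → ℤ} (h : ∃ l, a l < b l) :
    shiftMonomial K a b ∈ varIdeal K n := by
  obtain ⟨l, hl⟩ := h
  have : exponent (b - a) = (exponent (b - a) - Finsupp.single l 1) + Finsupp.single l 1 := by
    rw [tsub_add_cancel_of_le]
    rw [Finsupp.single_le_iff, exponent_apply, Pi.sub_apply]
    omega
  rw [shiftMonomial, this, ← mul_one (1 : K), ← MvPolynomial.monomial_mul]
  exact Ideal.mul_mem_left _ _ (Ideal.subset_span ⟨l, rfl⟩)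

/-- Multiplication by a monomial on a graded free module. -/
def freeShift {ι : Type w} (deg : ι → Fin n → ℤ) {a b : Fin n → ℤ} (h : a ≤ b) :
    freeGrading K deg a →ₗ[K] freeGrading K deg b :=
  (Algebra.lsmul K K (ι →₀ MvPolynomial (Fin n) K) (shiftMonomial K a b)).restrict fun f hf => by
    have := smul_mem_freeGrading deg _ _ _ (shiftMonomial_mem h) f hf
    rwa [sub_add_cancel] at this

theorem coe_freeShift {ι : Type w} (deg : ι → Fin n → ℤ) {a b : Fin n → ℤ} (h : a ≤ b)
    (f : freeGrading K deg a) : (freeShift deg h f).1 = shiftMonomial K a b • f.1 := rfl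

/-- The coordinates of homogeneous elements of a graded free module. -/
def freeCoord {ι : Type w} (deg : ι → Fin n → ℤ) (a : Fin n → ℤ) :
    freeGrading K deg a →ₗ[K] (ι →₀ K) :=
  (Finsupp.mapRange.linearMap (sumCoeff K n).toLinearMap).comp (Submodule.subtype _)

theorem freeCoord_apply {ι : Type w} (deg : ι → Fin n → ℤ) (a : Fin n → ℤ)
    (f : freeGrading K deg a) (j : ι) : freeCoord deg a f j = sumCoeff K n (f.1 j) := rfl

theorem freeCoord_injective {ι : Type w} (deg : ι → Fin n → ℤ) (a : Fin n → ℤ) :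
    Function.Injective (freeCoord (K := K) deg a) := by
  rw [injective_iff_map_eq_zero]
  intro f hf
  refine Subtype.ext (Finsupp.ext fun j => ?_)
  exact eq_zero_of_sumCoeff_eq_zero (f.2 j) (DFunLike.congr_fun hf j)

theorem freeCoord_freeShift {ι : Type w} (deg : ι → Fin n → ℤ) {a b : Fin n → ℤ} (h : a ≤ b)
    (f : freeGrading K deg a) : freeCoord deg b (freeShift deg h f) = freeCoord deg a f := by
  ext j
  rw [freeCoord_apply, freeCoord_apply, coe_freeShift, Finsupp.smul_apply, smul_eq_mul, map_mul,
    shiftMonomial, sumCoeff_monomial, one_mul]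

theorem deg_le_of_ne_zero {ι : Type w} (deg : ι → Fin n → ℤ) (a : Fin n → ℤ)
    (f : freeGrading K deg a) (j : ι) (h : f.1 j ≠ 0) : deg j ≤ a := by
  obtain ⟨c, -, h0⟩ := exists_eq_monomial (f.2 j)
  exact sub_nonneg.1 (h0 h)

theorem exists_freeCoord_eq_single {ι : Type w} (deg : ι → Fin n → ℤ) (j : ι) :
    ∃ f, freeCoord (K := K) deg (deg j) f = Finsupp.single j 1 := by
  classical
  refine ⟨⟨Finsupp.single j 1, fun l => ?_⟩, ?_⟩
  · rw [Finsupp.single_apply]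
    split_ifs with h
    · subst h
      rw [sub_self]
      exact MvPolynomial.isWeightedHomogeneous_one _ _
    · exact Submodule.zero_mem _
  · ext l
    rw [freeCoord_apply, Finsupp.single_apply, Finsupp.single_apply]
    split_ifs <;> simp

end Monomials

/-! ### Tensoring with the residue field as reduction modulo the variables -/

section Tensor

open scoped TensorProduct

variable {K : Type u} [Field K] {n : ℕ} {ι : Type w}

theorem smul_one_residueField (p : MvPolynomial (Fin n) K) :
    p • (1 : ResidueField K n) = Ideal.Quotient.mk (varIdeal K n) p :=
  congrArg (Ideal.Quotient.mk (varIdeal K n)) (mul_one p)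

theorem sub_constantCoeff_mem_varIdeal (q : MvPolynomial (Fin n) K) :
    q - MvPolynomial.C (MvPolynomial.constantCoeff q) ∈ varIdeal K n := by
  induction q using MvPolynomial.induction_on with
  | C c => simp
  | add p q hp hq =>
    have := Ideal.add_mem _ hp hq
    rwa [← add_sub_add_comm, ← map_add, ← map_add] at this
  | mul_X p l _ =>
    rw [map_mul, MvPolynomial.constantCoeff_X, mul_zero, map_zero, sub_zero]
    exact Ideal.mul_mem_left _ _ (Ideal.subset_span ⟨l, rfl⟩)

/-- The map `f ↦ f ⊗ 1`. -/
def tmulOne : (ι →₀ MvPolynomial (Fin n) K) →ₗ[K]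
    TensorS K n (ι →₀ MvPolynomial (Fin n) K) (ResidueField K n) where
  toFun f := TensorS.tmul K n f 1
  map_add' f g := TensorProduct.add_tmul f g _
  map_smul' c f := (TensorProduct.smul_tmul' c f _).symm

theorem tmulOne_smul_of_mem (p : MvPolynomial (Fin n) K) (hp : p ∈ varIdeal K n)
    (f : ι →₀ MvPolynomial (Fin n) K) : tmulOne (p • f) = 0 := by
  change (p • f) ⊗ₜ[MvPolynomial (Fin n) K] (1 : ResidueField K n) = 0
  have : p • (1 : ResidueField K n) = 0 := by
    rw [smul_one_residueField]
    exact Ideal.Quotient.eq_zero_iff_mem.2 hp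
  rw [TensorProduct.smul_tmul, this, TensorProduct.tmul_zero]

theorem mem_varIdeal_of_tmulOne_eq_zero (f : ι →₀ MvPolynomial (Fin n) K)
    (h : tmulOne f = 0) (j : ι) : f j ∈ varIdeal K n := by
  have h1 : (f ⊗ₜ[MvPolynomial (Fin n) K] (1 : ResidueField K n)) = 0 := h
  have h2 := congrArg (TensorProduct.lid (MvPolynomial (Fin n) K) (ResidueField K n) ∘
    (Finsupp.lapply (R := MvPolynomial (Fin n) K) j).rTensor (ResidueField K n)) h1
  simp only [Function.comp_apply, LinearMap.rTensor_tmul, map_zero, TensorProduct.lid_tmul,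
    Finsupp.lapply_apply] at h2
  rw [smul_one_residueField] at h2
  exact Ideal.Quotient.eq_zero_iff_mem.1 h2

/-- The residue field lives in degree `0` and consists of scalars, which can be moved to the left
factor. -/
theorem tensorGrading_eq_map (deg : ι → Fin n → ℤ) (a : Fin n → ℤ) :
    tensorGrading K n (freeGrading K deg) (residueGrading K n) a =
      (freeGrading K deg a).map tmulOne := by
  apply le_antisymm
  · rw [tensorGrading, Submodule.span_le]
    rintro _ ⟨b, c, rfl, f, hf, y, hy, rfl⟩
    rw [residueGrading] at hy
    split_ifs at hy with hc
    · subst hc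
      rw [add_zero]
      obtain ⟨q, rfl⟩ := Ideal.Quotient.mk_surjective y
      refine ⟨MvPolynomial.constantCoeff q • f, Submodule.smul_mem _ _ hf, ?_⟩
      change (MvPolynomial.constantCoeff q • f) ⊗ₜ[MvPolynomial (Fin n) K] (1 : ResidueField K n) =
        f ⊗ₜ[MvPolynomial (Fin n) K] (Ideal.Quotient.mk _ q)
      rw [Ideal.Quotient.eq.2 (sub_constantCoeff_mem_varIdeal q),
        ← algebraMap_smul (MvPolynomial (Fin n) K) (MvPolynomial.constantCoeff q) f,
        TensorProduct.smul_tmul, smul_one_residueField]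
      rfl
    · rw [Submodule.mem_bot] at hy
      subst hy
      change f ⊗ₜ[MvPolynomial (Fin n) K] (0 : ResidueField K n) ∈ _
      rw [TensorProduct.tmul_zero]
      exact Submodule.zero_mem _
  · rintro _ ⟨f, hf, rfl⟩
    refine Submodule.subset_span ⟨a, 0, add_zero a, f, hf, 1, ?_, rfl⟩
    rw [residueGrading, if_pos rfl]
    trivial

end Tensor

theorem exists_homogeneous_preimage {K : Type u} [Field K] {n : ℕ} {ι : Type w} {ι' : Type w'}
    (deg : ι → Fin n → ℤ) (deg' : ι' → Fin n → ℤ)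
    (φ : (ι →₀ MvPolynomial (Fin n) K) →ₗ[MvPolynomial (Fin n) K] (ι' →₀ MvPolynomial (Fin n) K))
    (hφ : ∀ a, ∀ f ∈ freeGrading K deg a, φ f ∈ freeGrading K deg' a) (a : Fin n → ℤ)
    (g : ι →₀ MvPolynomial (Fin n) K) (hg : φ g ∈ freeGrading K deg' a) :
    ∃ g' ∈ freeGrading K deg a, φ g' = φ g := by
  classical
  have hmem : g ∈ ⨆ a, freeGrading K deg a := by rw [iSup_freeGrading]; trivial
  obtain ⟨s, hs, rfl⟩ := (Submodule.mem_iSup_iff_exists_finsupp _ _).1 hmem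
  refine ⟨s a, hs a, ?_⟩
  set f := φ (s.sum fun _ x => x) with hf
  -- The components `φ (s b)`, with `f` subtracted in degree `a`, sum to zero; hence each vanishes,
  -- and in degree `a` this reads `φ (s a) = f`.
  have h := indep_freeGrading deg' (insert a s.support) (fun b => φ (s b) - if b = a then f else 0)
    (fun b => ?_) ?_ a (Finset.mem_insert_self _ _)
  · simpa [sub_eq_zero] using h
  · refine Submodule.sub_mem _ (hφ b _ (hs b)) ?_
    split_ifs with hb
    · subst hb; exact hg
    · exact Submodule.zero_mem _
  · rw [Finset.sum_sub_distrib, Finset.sum_ite_eq', if_pos (Finset.mem_insert_self _ _), hf,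
      Finsupp.sum, map_sum, sub_eq_zero]
    symm
    refine Finset.sum_subset (Finset.subset_insert _ _) fun b _ hb => ?_
    rw [Finsupp.notMem_support_iff.1 hb, map_zero]

/-! ### The complex of a graded free resolution and its Koszul homology -/

namespace GradedFreeResolution

variable {K : Type u} [Field K] {n : ℕ} {M : Type v} [AddCommGroup M] [Module K M]
  [Module (MvPolynomial (Fin n) K) M] {𝓜 : (Fin n → ℤ) → Submodule K M}
  (R : GradedFreeResolution 𝓜)

/-- The piece of degree `a` of the differential `F_{m+1} → F_m`. -/
def dPiece (m : ℕ) (a : Fin n → ℤ) :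
    freeGrading K (R.deg (m + 1)) a →ₗ[K] freeGrading K (R.deg m) a :=
  ((R.d m).restrictScalars K).restrict (R.d_mem m a)

theorem dPiece_dPiece (m a f) : R.dPiece m a (R.dPiece (m + 1) a f) = 0 :=
  Subtype.ext ((R.exact m).apply_apply_eq_zero f.1)

theorem dPiece_freeShift (m) {a b : Fin n → ℤ} (h : a ≤ b) (f) :
    R.dPiece m b (freeShift _ h f) = freeShift _ h (R.dPiece m a f) :=
  Subtype.ext ((R.d m).map_smul _ _)

theorem exists_dPiece_eq (m a) (f : freeGrading K (R.deg m) a)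
    (h : f.1 ∈ LinearMap.range (R.d m)) : ∃ g, R.dPiece m a g = f := by
  obtain ⟨g, hg⟩ := h
  obtain ⟨g', hg', h'⟩ := exists_homogeneous_preimage _ _ (R.d m) (R.d_mem m) a g
    (by rw [hg]; exact f.2)
  exact ⟨⟨g', hg'⟩, Subtype.ext (h'.trans hg)⟩

theorem freeShift_freeShift {ι : Type w} (deg : ι → Fin n → ℤ) {a b c : Fin n → ℤ}
    (h : a ≤ b) (h' : b ≤ c) (f : freeGrading K deg a) :
    freeShift deg h' (freeShift deg h f) = freeShift deg (h.trans h') f :=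
  Subtype.ext (by rw [coe_freeShift, coe_freeShift, coe_freeShift, smul_smul,
    shiftMonomial_mul h h'])

theorem freeShift_refl {ι : Type w} (deg : ι → Fin n → ℤ) (a : Fin n → ℤ)
    (f : freeGrading K deg a) : freeShift deg (le_refl a) f = f :=
  Subtype.ext (by rw [coe_freeShift, shiftMonomial_self, one_smul])

/-- The complex of graded pieces of a graded free resolution. -/
def toComplex : GradedComplex.{u, max u v} K n where
  -- A product over at most one index: it extends the resolution by zero to negative positions and
  -- absorbs equalities of indices without casts.
  obj i a := ∀ m : {m : ℕ // (m : ℤ) = i}, freeGrading K (R.deg m.1) a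
  d i a := LinearMap.pi fun m =>
    (R.dPiece m.1 a).comp (LinearMap.proj (⟨m.1 + 1, by have := m.2; push_cast; omega⟩ :
      {m : ℕ // (m : ℤ) = i}))
  x i a b h := LinearMap.pi fun m => (freeShift (R.deg m.1) h).comp (LinearMap.proj m)
  d_d i a u := funext fun m => R.dPiece_dPiece m.1 a _
  d_x i a b h u := funext fun m => R.dPiece_freeShift m.1 h _
  x_refl i a u := funext fun m => freeShift_refl _ _ _
  x_x i a b c h h' u := funext fun m => freeShift_freeShift _ h h' _

theorem exists_apply_eq {i : ℤ} {a : Fin n → ℤ} (m : {m : ℕ // (m : ℤ) = i})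
    (f : freeGrading K (R.deg m.1) a) : ∃ u : R.toComplex.obj i a, u m = f :=
  ⟨Function.update (0 : ∀ m : {m : ℕ // (m : ℤ) = i}, freeGrading K (R.deg m.1) a) m f,
    Function.update_self _ _ _⟩

/-- Everything in homological degrees `i ≠ 0`, and the boundaries in homological degree `0`. -/
def truncation (i : ℤ) (a : Fin n → ℤ) : Submodule K (R.toComplex.obj i a) where
  carrier := {u | ∀ m : {m : ℕ // (m : ℤ) = i}, m.1 = 0 → u m ∈ LinearMap.range (R.dPiece m.1 a)}
  add_mem' hu hv m hm := Submodule.add_mem _ (hu m hm) (hv m hm)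
  zero_mem' _ _ := Submodule.zero_mem _
  smul_mem' c _ hu m hm := Submodule.smul_mem _ c (hu m hm)

/-- The cokernel of `F_1 → F_0`, as a complex concentrated in degree `0`. -/
def toModule : GradedComplex.{u, max u v} K n where
  obj i a := R.toComplex.obj i a ⧸ R.truncation i a
  d _ _ := 0
  x i a b h := Submodule.mapQ _ _ (R.toComplex.x i h) (by
    intro u hu m hm
    obtain ⟨f, hf⟩ := hu m hm
    exact ⟨freeShift _ h f, (R.dPiece_freeShift m.1 h f).trans (congrArg _ hf)⟩)
  d_d _ _ _ := rfl
  d_x _ _ _ _ _ := (map_zero _).symm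
  x_refl i a u := by
    obtain ⟨u, rfl⟩ := Submodule.Quotient.mk_surjective _ u
    exact congrArg Submodule.Quotient.mk (R.toComplex.x_refl i a u)
  x_x i a b c h h' u := by
    obtain ⟨u, rfl⟩ := Submodule.Quotient.mk_surjective _ u
    exact congrArg Submodule.Quotient.mk (R.toComplex.x_x i h h' u)

theorem subsingleton_toModule {i : ℤ} {a : Fin n → ℤ} (h : ∀ u, u ∈ R.truncation i a) :
    Subsingleton (R.toModule.obj i a) :=
  Submodule.Quotient.subsingleton_iff.2 (eq_top_iff.2 fun u _ => h u)

theorem isModule_toModule : R.toModule.IsModule := by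
  refine fun i hi a => R.subsingleton_toModule fun u m hm => absurd ?_ hi
  rw [← m.2, hm, Nat.cast_zero]

/-- By exactness at `F_0` the cokernel embeds into `M` degree by degree, so it vanishes wherever `𝓜`
does. -/
theorem isBounded_toModule (h : BoundedBelow 𝓜) : R.toModule.IsBounded := by
  obtain ⟨c, hc⟩ := h
  refine ⟨c, fun i a ha => R.subsingleton_toModule ?_⟩
  rintro u ⟨m, hm⟩ (rfl : m = 0)
  refine R.exists_dPiece_eq 0 a _ ((R.exact_aug _).1 ?_)
  have := R.aug_mem a _ (u ⟨0, hm⟩).2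
  rw [hc a ha] at this
  exact this

/-- The augmentation is a quasi-isomorphism. -/
def augmentation : GradedComplex.SurjQuasiIso R.toComplex R.toModule where
  g i a := (R.truncation i a).mkQ
  g_d i a u := (Submodule.Quotient.mk_eq_zero _).2 fun _ _ => ⟨_, rfl⟩
  g_x _ _ _ _ _ := rfl
  g_surjective i a := Submodule.mkQ_surjective _
  acyclic i a y h1 h2 := by
    have h1' : y ∈ R.truncation (i - 1) a := (Submodule.Quotient.mk_eq_zero _).1 h1
    have key : ∀ m : {m : ℕ // (m : ℤ) = i - 1}, ∃ f, R.dPiece m.1 a f = y m := by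
      rintro ⟨m, hm⟩
      cases m with
      | zero => exact h1' ⟨0, hm⟩ rfl
      | succ m =>
        have h3 := congrFun h2 ⟨m, by push_cast at hm; omega⟩
        exact R.exists_dPiece_eq _ _ _ ((R.exact m _).1 (congrArg Subtype.val h3))
    choose f hf using key
    -- Lift the cycle componentwise; the component in `F_0` is set to zero so that `v` lies in the
    -- truncation.
    let v : R.toComplex.obj i a := fun m => match m with
      | ⟨0, _⟩ => 0
      | ⟨m + 1, hm⟩ => f ⟨m, by push_cast at hm; omega⟩
    refine ⟨v, (Submodule.Quotient.mk_eq_zero _).2 ?_, funext fun m => hf m⟩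
    rintro ⟨m, hm⟩ (rfl : m = 0)
    exact Submodule.zero_mem _

/-- The coordinates of the elements of `F_m` of degree `a`. -/
def coord {i : ℤ} (m : {m : ℕ // (m : ℤ) = i}) (a : Fin n → ℤ) :
    R.toComplex.obj i a →ₗ[K] (R.ι m.1 →₀ K) :=
  (freeCoord (R.deg m.1) a).comp (LinearMap.proj m)

theorem coord_apply {i : ℤ} (m : {m : ℕ // (m : ℤ) = i}) (a : Fin n → ℤ) (u j) :
    R.coord m a u j = sumCoeff K n ((u m).1 j) := rfl

theorem coord_injective {i : ℤ} (m : {m : ℕ // (m : ℤ) = i}) (a : Fin n → ℤ) :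
    Function.Injective (R.coord m a) := by
  intro u v huv
  have h1 : u m = v m := freeCoord_injective _ _ huv
  obtain ⟨m, hm⟩ := m
  funext ⟨m', hm'⟩
  obtain rfl : m' = m := by omega
  exact h1

theorem coord_x {i : ℤ} (m : {m : ℕ // (m : ℤ) = i}) {a b : Fin n → ℤ} (h : a ≤ b) (u) :
    R.coord m b (R.toComplex.x i h u) = R.coord m a u := freeCoord_freeShift _ h _

theorem deg_le_of_coord_ne_zero {i : ℤ} (m : {m : ℕ // (m : ℤ) = i}) (a : Fin n → ℤ) (u j)
    (hj : R.coord m a u j ≠ 0) : R.deg m.1 j ≤ a := by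
  refine deg_le_of_ne_zero (R.deg m.1) a (u m) j fun h0 => hj ?_
  rw [coord_apply, h0, map_zero]

theorem exists_coord_eq_single {i : ℤ} (m : {m : ℕ // (m : ℤ) = i}) (j) :
    ∃ u, R.coord m (R.deg m.1 j) u = Finsupp.single j 1 := by
  obtain ⟨f, hf⟩ := exists_freeCoord_eq_single (K := K) (R.deg m.1) j
  obtain ⟨u, hu⟩ := R.exists_apply_eq m f
  exact ⟨u, (congrArg _ hu).trans hf⟩

theorem regular_toComplex : R.toComplex.Regular := by
  refine GradedComplex.regular_of_coordinates.{u, max u v, max u v} fun i => ?_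
  by_cases hi : ∃ m : ℕ, (m : ℤ) = i
  · obtain ⟨m, hm⟩ := hi
    exact ⟨R.ι m, R.deg m, R.coord ⟨m, hm⟩, R.coord_injective _, R.coord_x _,
      R.deg_le_of_coord_ne_zero ⟨m, hm⟩, R.exists_coord_eq_single ⟨m, hm⟩⟩
  · exact ⟨PEmpty, fun j => j.elim, fun a => 0, fun a u v _ => funext fun m => absurd ⟨m.1, m.2⟩ hi,
      fun _ _ => rfl, fun _ _ j => j.elim, fun j => j.elim⟩

theorem mem_varSubmodule_toComplex {i : ℤ} (m : {m : ℕ // (m : ℤ) = i}) (a) (u) :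
    u ∈ R.toComplex.varSubmodule i a n ↔ tmulOne (u m).1 = 0 := by
  constructor
  · intro h
    let φ : R.toComplex.obj i a →ₗ[K] R.TensorK m.1 :=
      tmulOne.comp ((Submodule.subtype _).comp (LinearMap.proj m))
    have hle : R.toComplex.varSubmodule i a n ≤ LinearMap.ker φ := by
      refine GradedComplex.varSubmodule_le fun b hb ⟨l, _, hl⟩ v => ?_
      exact tmulOne_smul_of_mem _ (shiftMonomial_mem_varIdeal ⟨l, hl⟩) _
    exact hle h
  · intro h
    rw [GradedComplex.mem_varSubmodule_iff_of_coordinates (R.deg m.1) (R.coord m)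
      (R.coord_injective m) (R.coord_x m) (R.deg_le_of_coord_ne_zero m)
      (R.exists_coord_eq_single m)]
    intro j hj
    by_contra! hl
    have hja : R.deg m.1 j = a :=
      le_antisymm (R.deg_le_of_coord_ne_zero m a u j hj) fun l => hl l l.2
    apply hj
    have h0 : (u m).1 j ∈ polyGrading K n 0 := by
      have := (u m).2 j
      rwa [hja, sub_self] at this
    rw [coord_apply, eq_zero_of_mem_varIdeal h0 (mem_varIdeal_of_tmulOne_eq_zero _ h j), map_zero]

/-- A complex of free modules is regular, so its Koszul homology is that of its reduction modulo the
variables, which is `F ⊗ K`. -/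
theorem koszulRank_toComplex (a) (i : ℕ) :
    R.toComplex.koszulRank a (i + 1) = rk (R.cycles i a) (R.boundaries i a) := by
  rw [R.regular_toComplex.koszulRank_eq]
  have hi : (i : ℤ) = i + 1 - 1 := by ring
  let φ : R.toComplex.obj (i + 1 - 1) a →ₗ[K] R.TensorK i :=
    tmulOne.comp ((Submodule.subtype _).comp
      (LinearMap.proj (⟨i, hi⟩ : {m : ℕ // (m : ℤ) = i + 1 - 1})))
  have hφ : ∀ u, u ∈ R.toComplex.varSubmodule (i + 1 - 1) a n ↔ φ u = 0 := fun u =>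
    R.mem_varSubmodule_toComplex ⟨i, hi⟩ a u
  have hφd : ∀ y : R.toComplex.obj (i + 1) a, φ (R.toComplex.d (i + 1) a y) =
      R.tensorD i (tmulOne (y ⟨i + 1, by push_cast; ring⟩).1) := fun y => rfl
  have hchains : ∀ i a, R.chains i a = (freeGrading K (R.deg i) a).map tmulOne := fun i a =>
    tensorGrading_eq_map _ _
  have hφc : ∀ u, φ u ∈ R.chains i a := by
    intro u
    rw [hchains]
    exact ⟨_, (u ⟨i, hi⟩).2, rfl⟩
  have hcyc : ∀ u, u ∈ (R.toComplex.varSubmodule (i + 1 - 1 - 1) a n).comap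
      (R.toComplex.d (i + 1 - 1) a) ↔ φ u ∈ R.cycles i a := by
    intro u
    cases i with
    | zero =>
      have : IsEmpty {m : ℕ // (m : ℤ) = (0 : ℕ) + 1 - 1 - 1} := ⟨fun m => by
        have := m.2
        omega⟩
      have h0 : R.toComplex.d (((0 : ℕ) : ℤ) + 1 - 1) a u = 0 := funext fun m => isEmptyElim m
      rw [Submodule.mem_comap, h0]
      exact ⟨fun _ => hφc u, fun _ => Submodule.zero_mem _⟩
    | succ i =>
      rw [Submodule.mem_comap, R.mem_varSubmodule_toComplex ⟨i, by push_cast; ring⟩]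
      exact ⟨fun h => ⟨hφc u, h⟩, fun h => h.2⟩
  refine rk_eq_of_map φ (fun z hz => (hcyc z).1 hz) ?_ ?_ ?_
  · intro z hz
    obtain ⟨_, ⟨y, rfl⟩, m, hm, rfl⟩ := Submodule.mem_sup.1 hz
    rw [map_add, (hφ m).1 hm, add_zero, hφd]
    refine Submodule.mem_map_of_mem ?_
    rw [hchains]
    exact Submodule.mem_map_of_mem (y ⟨i + 1, _⟩).2
  · intro z hz
    have hz' : z ∈ R.chains i a := by
      cases i with
      | zero => exact hz
      | succ i => exact hz.1
    rw [hchains] at hz'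
    obtain ⟨f, hf, rfl⟩ := hz'
    obtain ⟨u, hu'⟩ := R.exists_apply_eq ⟨i, hi⟩ ⟨f, hf⟩
    have hu : φ u = tmulOne f := congrArg (fun y => tmulOne y.1) hu'
    refine ⟨u, (hcyc u).2 (by rw [hu]; exact hz), ?_⟩
    rw [hu, sub_self]
    exact Submodule.zero_mem _
  · rintro z - ⟨t, ht, hzt⟩
    rw [hchains] at ht
    obtain ⟨f, hf, rfl⟩ := ht
    have hi' : ((i + 1 : ℕ) : ℤ) = i + 1 := by push_cast; ring
    obtain ⟨y, hy⟩ := R.exists_apply_eq ⟨i + 1, hi'⟩ ⟨f, hf⟩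
    rw [← add_sub_cancel (R.toComplex.d (i + 1) a y) z]
    refine Submodule.add_mem_sup ⟨y, rfl⟩ ?_
    rw [hφ, map_sub, hφd, hy, ← hzt, sub_self]

end GradedFreeResolution

/-! ### Betti numbers and cardinal sums -/

variable {K : Type u} [Field K] {n : ℕ} {M : Type v} [AddCommGroup M] [Module K M]
  [Module (MvPolynomial (Fin n) K) M] [IsScalarTower K (MvPolynomial (Fin n) K) M]

/-- Balancing of `Tor`: the Koszul homology of the resolution is `Tor`, and the augmentation
identifies it with that of the resolved module. -/
theorem gradedBetti_eq_koszulRank (𝓜 : (Fin n → ℤ) → Submodule K M) [DirectSum.Decomposition 𝓜]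
    [SetLike.GradedSMul (polyGrading K n) 𝓜] (i : ℕ) (a : Fin n → ℤ) :
    gradedBetti 𝓜 i a =
      (Classical.choice (nonempty_gradedFreeResolution 𝓜)).toModule.koszulRank a (i + 1) := by
  rw [← (GradedFreeResolution.augmentation _).koszulRank_eq,
    GradedFreeResolution.koszulRank_toComplex]
  rfl

theorem exists_finset_choose_le_sum_gradedBetti (𝓜 : (Fin n → ℤ) → Submodule K M)
    [DirectSum.Decomposition 𝓜] [SetLike.GradedSMul (polyGrading K n) 𝓜] (hM : BoundedBelow 𝓜)
    (p : ℕ) (a : Fin n → ℤ) (hβ : gradedBetti 𝓜 p a ≠ 0) (i : ℕ) :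
    ∃ T : Finset (Fin n → ℤ), (∀ b ∈ T, b ≤ a ∧ totalDegree b ≤ totalDegree a - p + i) ∧
      (p.choose i : Cardinal) ≤ ∑ b ∈ T, gradedBetti 𝓜 i b := by
  simp only [gradedBetti_eq_koszulRank] at hβ ⊢
  set R := Classical.choice (nonempty_gradedFreeResolution 𝓜)
  have h := R.isModule_toModule
  have hb := R.isBounded_toModule hM
  exact GradedComplex.bettiBound_of_syzygy _ h hb
    (GradedComplex.bettiBound_of_torsionFree _ (GradedComplex.isModule_syzygy h)
      (GradedComplex.isBounded_syzygy hb) GradedComplex.torsionFree_syzygy) p a hβ i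

theorem sum_finset_le_cardinal_sum {ι : Type w} (f : ι → Cardinal.{w'}) (T : Finset ι) :
    Cardinal.lift.{w} (∑ b ∈ T, f b) ≤ Cardinal.sum f := by
  classical
  have key : Cardinal.lift.{w} (∑ b ∈ T, f b) ≤ Cardinal.sum fun b => if b ∈ T then f b else 0 := by
    induction T using Finset.induction_on with
    | empty => simp
    | insert a T ha ih =>
      have h1 : (fun b => if b ∈ insert a T then f b else 0) =
          (fun b => if b = a then f b else 0) + fun b => if b ∈ T then f b else 0 := by
        funext b
        by_cases hb : b = a
        · subst hb
          simp [ha]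
        · simp [hb]
      rw [Finset.sum_insert ha, Cardinal.lift_add, h1, Cardinal.sum_add_distrib]
      refine add_le_add ?_ ih
      simpa using Cardinal.lift_le_sum (fun b => if b = a then f b else 0) a
  refine key.trans (Cardinal.sum_le_sum _ _ fun b => ?_)
  split_ifs
  · exact le_rfl
  · exact zero_le

end MultigradedBetti

open MultigradedBetti in
theorem corollary4p1 {K : Type*} [Field K] {n : ℕ} {M : Type*} [AddCommGroup M] [Module K M]
    [Module (MvPolynomial (Fin n) K) M] [IsScalarTower K (MvPolynomial (Fin n) K) M]
    (𝓜 : (Fin n → ℤ) → Submodule K M) [DirectSum.Decomposition 𝓜]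
    [SetLike.GradedSMul (polyGrading K n) 𝓜] (hM : BoundedBelow 𝓜)
    (p : ℕ) (a : Fin n → ℤ) (hβ : gradedBetti 𝓜 p a ≠ 0) :
    (∀ i ≤ p, (p.choose i : Cardinal) ≤ Cardinal.sum
      fun b : {b : Fin n → ℤ // b ≤ a ∧ totalDegree b ≤ totalDegree a - p + i} =>
        gradedBetti 𝓜 i b.1) ∧
    (∀ i ≤ p, (p.choose i : Cardinal) ≤ totalBetti 𝓜 i) ∧
    (2 ^ p : Cardinal) ≤ ∑ i ∈ Finset.range (p + 1), totalBetti 𝓜 i := by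
  classical
  have key := exists_finset_choose_le_sum_gradedBetti 𝓜 hM p a hβ
  have htotal : ∀ i, (p.choose i : Cardinal) ≤ totalBetti 𝓜 i := by
    intro i
    obtain ⟨T, -, h2⟩ := key i
    refine h2.trans ?_
    have := sum_finset_le_cardinal_sum (fun b => gradedBetti 𝓜 i b) T
    rwa [Cardinal.lift_uzero] at this
  refine ⟨fun i _ => ?_, fun i _ => htotal i, ?_⟩
  · obtain ⟨T, h1, h2⟩ := key i
    refine h2.trans ?_
    have := sum_finset_le_cardinal_sum
      (fun b : {b : Fin n → ℤ // b ≤ a ∧ totalDegree b ≤ totalDegree a - p + i} =>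
        gradedBetti 𝓜 i b.1) (T.subtype _)
    rw [Cardinal.lift_uzero] at this
    refine le_trans (le_of_eq ?_) this
    rw [Finset.sum_subtype_of_mem (fun b => gradedBetti 𝓜 i b) h1]
  · calc (2 ^ p : Cardinal) = ((∑ i ∈ Finset.range (p + 1), p.choose i : ℕ) : Cardinal) := by
          rw [Nat.sum_range_choose]; push_cast; rfl
      _ = ∑ i ∈ Finset.range (p + 1), (p.choose i : Cardinal) := Nat.cast_sum _ _
      _ ≤ _ := Finset.sum_le_sum fun i _ => htotal i
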